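/- Let $n\ge 2$ and let $\partial$ denote the generator of $\mathbb C[\partial]$. All linearity is over $\mathbb C$, all $\lambda$'s and $\mu$'s are commuting indeterminates, and for a $\mathbb C[\partial]$-module $M$ we write $M[\lambda_1,\dots,\lambda_r]=\mathbb C[\partial,\lambda_1,\dots,\lambda_r]\otimes_{\mathbb C[\partial]}M$. Brackets, actions and cochains are extended linearly over polynomials in the indeterminates. An **$n$-Lie conformal algebra** is a $\mathbb C[\partial]$-module $R$ with a $\mathbb C$-multilinear bracket $(a^1,\dots,a^n)\mapsto[a^1{}_{\lambda_1}\cdots a^{n-1}{}_{\lambda_{n-1}}a^n]\in R[\lambda_1,\dots,\lambda_{n-1}]$ such that * replacing $a^i$ by $\partial a^i$ multiplies the bracket by $-\lambda_i$ for $i\le n-1$, and by $\partial+\lambda_1+\cdots+\lambda_{n-1}$ for $i=n$; * the bracket changes sign when $(a^i,\lambda_i)$ and $(a^{i+1},\lambda_{i+1})$ are interchanged ($1\le i\le n-2$), and $[a^1{}_{\lambda_1}\cdots a^{n-1}{}_{\lambda_{n-1}}a^n]=-[a^1{}_{\lambda_1}\cdots a^{n-2}{}_{\lambda_{n-2}}\,a^n{}_{-\partial-\lambda_1-\cdots-\lambda_{n-1}}a^{n-1}]$,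 with powers of $\partial$ placed on the left; * $\sum_{i=1}^n(-1)^{n-i}[a^1{}_{\lambda_1}\cdots\widehat{a^i{}_{\lambda_i}}\cdots a^n{}_{\lambda_n}[a^i{}_{\lambda_i}b^2{}_{\lambda_{n+1}}\cdots{}_{\lambda_{2n-2}}b^n]]=[[a^1{}_{\lambda_1}\cdots{}_{\lambda_{n-1}}a^n]_{\lambda_1+\cdots+\lambda_n}b^2{}_{\lambda_{n+1}}\cdots{}_{\lambda_{2n-2}}b^n]$. A **conformal representation** of $R$ is a $\mathbb C[\partial]$-module $M$ with a $\mathbb C$-multilinear action $(a^1,\dots,a^{n-1},v)\mapsto a^1{}_{\lambda_1}\cdots a^{n-1}{}_{\lambda_{n-1}}v\in M[\lambda_1,\dots,\lambda_{n-1}]$ such that * replacing $a^i$ by $\partial a^i$ multiplies it by $-\lambda_i$, and replacing $v$ by $\partial v$ multiplies it by $\partial+\lambda_1+\cdots+\lambda_{n-1}$; * it changes sign when $(a^i,\lambda_i)$ and $(a^{i+1},\lambda_{i+1})$ are interchanged ($1\le i\le n-2$); * $\sum_{i=1}^n(-1)^{n-i}a^1{}_{\lambda_1}\cdots\widehat{a^i{}_{\lambda_i}}\cdots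 a^n{}_{\lambda_n}(a^i{}_{\lambda_i}b^1{}_{\lambda_{n+1}}\cdots b^{n-2}{}_{\lambda_{2n-2}}v)=[a^1{}_{\lambda_1}\cdots{}_{\lambda_{n-1}}a^n]_{\lambda_1+\cdots+\lambda_n}b^1{}_{\lambda_{n+1}}\cdots b^{n-2}{}_{\lambda_{2n-2}}v$; * $a^1{}_{\lambda_1}\cdots a^{n-1}{}_{\lambda_{n-1}}(b^1{}_{\mu_1}\cdots b^{n-1}{}_{\mu_{n-1}}v)-b^1{}_{\mu_1}\cdots b^{n-1}{}_{\mu_{n-1}}(a^1{}_{\lambda_1}\cdots a^{n-1}{}_{\lambda_{n-1}}v)=\sum_{l=1}^{n-1}b^1{}_{\mu_1}\cdots[a^1{}_{\lambda_1}\cdots a^{n-1}{}_{\lambda_{n-1}}b^l]_{\mu_l+\lambda_1+\cdots+\lambda_{n-1}}\cdots b^{n-1}{}_{\mu_{n-1}}v$. For $q\ge1$ let $\widetilde C^q(R,M)$ be the space of $\mathbb C$-multilinear maps $\gamma$ sending $q-1$ blocks $a^i=(a^i_1,\dots,a^i_{n-1})$, $1\le i\le q-1$, of elements of $R$ and one more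 element $z\in R$ to $\gamma_{\lambda^1,\dots,\lambda^{q-1},\mu}(a^1,\dots,a^{q-1},z)\in M[\lambda^i_j,\mu]$, where $\lambda^i=(\lambda^i_1,\dots,\lambda^i_{n-1})$, satisfying * *conformal antilinearity*: replacing $a^i_j$ by $\partial a^i_j$ multiplies $\gamma$ by $-\lambda^i_j$, and replacing $z$ by $\partial z$ multiplies it by $-\mu$; * *skew-symmetry*: for each $i$, $\gamma$ is skew-symmetric under simultaneous permutations of the arguments and the indeterminates of the $i$-th block, where $z$ (with $\mu$) is counted in the last block, which therefore has $n$ entries when $q\ge2$. For $\gamma\in\widetilde C^q(R,M)$ put $|\lambda^i|=\lambda^i_1+\cdots+\lambda^i_{n-1}$ and $$\begin{aligned} (D\gamma)_{\lambda^1,\dots,\lambda^q,\mu}(a^1,\dots,a^q,z) ={}&\sum_{1\le i<j\le q}\ \sum_{l=1}^{n-1}(-1)^i\,\gamma_{\lambda^1,\dots,\widehat{\lambda^i},\dots,\lambda^{j}(i,l),\dots,\lambda^q,\mu}(a^1,\dots,\widehat{a^i},\dots,a^{j}(i,l),\dots,a^q,z)\\ &+\sum_{i=1}^q(-1)^i\,\gamma_{\lambda^1,\dots,\widehat{\lambda^i},\dots,\lambda^q,\,\mu+|\lambda^i|}(a^1,\dots,\widehat{a^i},\dots,a^q,[a^i_1{}_{\lambda^i_1}\cdots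 a^i_{n-1}{}_{\lambda^i_{n-1}}z])\\ &+\sum_{i=1}^q(-1)^{i+1}\,a^i_1{}_{\lambda^i_1}\cdots a^i_{n-1}{}_{\lambda^i_{n-1}}\bigl(\gamma_{\lambda^1,\dots,\widehat{\lambda^i},\dots,\lambda^q,\mu}(a^1,\dots,\widehat{a^i},\dots,a^q,z)\bigr)\\ &+\sum_{i=1}^{n-1}(-1)^{n+q-i+1}\,a^q_1{}_{\lambda^q_1}\cdots\widehat{a^q_i{}_{\lambda^q_i}}\cdots a^q_{n-1}{}_{\lambda^q_{n-1}}z_{\mu}\bigl(\gamma_{\lambda^1,\dots,\lambda^{q-1},\lambda^q_i}(a^1,\dots,a^{q-1},a^q_i)\bigr), \end{aligned}$$ where $a^j(i,l)$ is $a^j$ with its $l$-th entry replaced by $[a^i_1{}_{\lambda^i_1}\cdots a^i_{n-1}{}_{\lambda^i_{n-1}}a^j_l]$, and $\lambda^j(i,l)$ is $\lambda^j$ with its $l$-th entry replaced by $\lambda^j_l+|\lambda^i|$. **Proposition.** Let $R$ be an $n$-Lie conformal algebra and $M$ a conformal representation of $R$. Then, for every $q\ge1$, this formula gives a well-defined linear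 map $D:\widetilde C^q(R,M)\to\widetilde C^{q+1}(R,M)$; in particular $D\gamma$ is again conformally antilinear and skew-symmetric. Moreover $D^2=0$, so $(\widetilde C^*(R,M),D)$ is a complex. -/

import Mathlib

open scoped Polynomial TensorProduct

noncomputable section

namespace NLieConformal

/-! Throughout, a `ℂ[∂]`-module is a module over the polynomial ring `ℂ[X]`, the variable `X` acting
as `∂`, and `n = m + 2` is the arity, so that `n - 1 = m + 1` and `n - 2 = m`
(every integer `n ≥ 2` is of this form). -/

/-- The operator `∂` of a `ℂ[∂]`-module. -/
def der {M : Type*} [AddCommGroup M] [Module ℂ[X] M] (v : M) : M := (Polynomial.X : ℂ[X]) • v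

/-- `M[λ_s : s ∈ σ]`, the polynomials in the indeterminates `λ_s` with coefficients in `M`.
For a `ℂ[∂]`-module `M` this is `ℂ[∂, λ_s : s ∈ σ] ⊗_{ℂ[∂]} M`. -/
abbrev LPoly (σ : Type*) (M : Type*) [AddCommGroup M] [Module ℂ M] : Type _ :=
  MvPolynomial σ ℂ ⊗[ℂ] M

section Eval

variable {σ : Type*} {M : Type*} [AddCommGroup M] [Module ℂ M]

/-- The value `f(λ) ∈ M` of `f ∈ M[λ_s : s ∈ σ]` at a complex point `λ`. -/
def ev (lam : σ → ℂ) : LPoly σ M →ₗ[ℂ] M :=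
  TensorProduct.lift ((LinearMap.lsmul ℂ M).comp (MvPolynomial.aeval lam).toLinearMap)

@[simp]
theorem ev_tmul (lam : σ → ℂ) (P : MvPolynomial σ ℂ) (v : M) :
    ev lam (P ⊗ₜ[ℂ] v) = MvPolynomial.eval lam P • v := by
  simp [ev, MvPolynomial.aeval_eq_eval]

/-- A polynomial with coefficients in `M` is determined by its values at complex points. Hence an
identity between such polynomials is the same as the identity between their values at all points;
the identities below are written in the second way. -/
theorem ev_injective {f g : LPoly σ M} (h : ∀ lam : σ → ℂ, ev lam f = ev lam g) : f = g := by
  classical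
  let b := Module.Basis.ofVectorSpace ℂ M
  let e := TensorProduct.equivFinsuppOfBasisRight (M := MvPolynomial σ ℂ) b
  have key : ∀ (lam : σ → ℂ) (x : LPoly σ M) (i),
      MvPolynomial.eval lam (e x i) = b.repr (ev lam x) i := by
    intro lam x i
    induction x using TensorProduct.induction_on with
    | zero => simp
    | tmul P v => simp [e, mul_comm]
    | add x y hx hy => simp [hx, hy]
  apply e.injective
  ext1 i
  apply MvPolynomial.funext
  intro lam
  rw [key, key, h]

/-- Substitution of elements `s_i` of `ℂ[∂]` for the indeterminates in `f = ∑ λ^k v_k`, all powers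
of `∂` standing to the left of the coefficients: `f ↦ ∑ s^k v_k`. -/
def evDer [Module ℂ[X] M] [IsScalarTower ℂ ℂ[X] M] (s : σ → ℂ[X]) : LPoly σ M →ₗ[ℂ] M :=
  TensorProduct.lift
    ((Algebra.lsmul ℂ ℂ M : ℂ[X] →ₐ[ℂ] Module.End ℂ M).toLinearMap.comp
      (MvPolynomial.aeval s : MvPolynomial σ ℂ →ₐ[ℂ] ℂ[X]).toLinearMap)

@[simp]
theorem evDer_tmul [Module ℂ[X] M] [IsScalarTower ℂ ℂ[X] M] (s : σ → ℂ[X])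
    (P : MvPolynomial σ ℂ) (v : M) :
    evDer s (P ⊗ₜ[ℂ] v) = (MvPolynomial.aeval s P : ℂ[X]) • v := by
  simp [evDer]

end Eval

/-- An `n`-Lie conformal algebra structure, `n = m + 2`, on a `ℂ[∂]`-module `R`. The bracket is
`ℂ`-linear in each of its `n` arguments; `bracket a b`, with `a = (a^1, …, a^{n-1})`, is
`[a^1_{λ_1} ⋯ a^{n-1}_{λ_{n-1}} b] ∈ R[λ_1, …, λ_{n-1}]`. -/
structure NLieConformalAlgebra (m : ℕ) (R : Type*) [AddCommGroup R] [Module ℂ R] [Module ℂ[X] R]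
    [IsScalarTower ℂ ℂ[X] R] where
  /-- The bracket, with polynomial values. -/
  bracket : MultilinearMap ℂ (fun _ : Fin (m + 1) => R) (R →ₗ[ℂ] LPoly (Fin (m + 1)) R)
  /-- Sesquilinearity in the first `n - 1` arguments. -/
  bracket_der_left : ∀ (lam : Fin (m + 1) → ℂ) (a : Fin (m + 1) → R) (b : R) (i : Fin (m + 1)),
    ev lam (bracket (Function.update a i (der (a i))) b) = -(lam i • ev lam (bracket a b))
  /-- Sesquilinearity in the last argument. -/
  bracket_der_right : ∀ (lam : Fin (m + 1) → ℂ) (a : Fin (m + 1) → R) (b : R),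
    ev lam (bracket a (der b)) = der (ev lam (bracket a b)) + (∑ i, lam i) • ev lam (bracket a b)
  /-- Skew-symmetry in neighbours among the first `n - 1` arguments. -/
  bracket_swap : ∀ (lam : Fin (m + 1) → ℂ) (a : Fin (m + 1) → R) (b : R) (i : Fin m),
    ev lam (bracket a b) =
      -ev (lam ∘ Equiv.swap i.castSucc i.succ) (bracket (a ∘ Equiv.swap i.castSucc i.succ) b)
  /-- Skew-symmetry in the last two arguments:
  `[a^1_{λ_1} ⋯ a^{n-1}_{λ_{n-1}} b] = -[a^1_{λ_1} ⋯ b_{-∂-λ_1-⋯-λ_{n-1}} a^{n-1}]`. -/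
  bracket_swap_last : ∀ (lam : Fin (m + 1) → ℂ) (a : Fin (m + 1) → R) (b : R),
    ev lam (bracket a b) =
      -evDer (Function.update (fun i => Polynomial.C (lam i)) (Fin.last m)
          (-Polynomial.X - Polynomial.C (∑ i, lam i)))
        (bracket (Function.update a (Fin.last m) b) (a (Fin.last m)))
  /-- The Filippov identity for `a^1, …, a^n`, `b = (b^2, …, b^{n-1})`, `c = b^n`,
  `lam = (λ_1, …, λ_n)` and `mu = (λ_{n+1}, …, λ_{2n-2})`. The index `i` is counted from `0`. -/
  filippov : ∀ (lam : Fin (m + 2) → ℂ) (mu : Fin m → ℂ) (a : Fin (m + 2) → R) (b : Fin m → R)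
      (c : R),
    ∑ i : Fin (m + 2), (-1 : ℂ) ^ (m + 1 - (i : ℕ)) •
        ev (fun k => lam (i.succAbove k)) (bracket (fun k => a (i.succAbove k))
          (ev (Fin.cons (lam i) mu) (bracket (Fin.cons (a i) b) c))) =
      ev (Fin.cons (∑ i, lam i) mu) (bracket
        (Fin.cons
          (ev (fun k => lam k.castSucc) (bracket (fun k => a k.castSucc) (a (Fin.last (m + 1)))))
          b)
        c)

section Algebra

variable {m : ℕ} {R : Type*} [AddCommGroup R] [Module ℂ R] [Module ℂ[X] R] [IsScalarTower ℂ ℂ[X] R]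

/-- The value `[a^1_{λ_1} ⋯ a^{n-1}_{λ_{n-1}} b]` of the bracket at a complex point. -/
def NLieConformalAlgebra.br (L : NLieConformalAlgebra m R) (lam : Fin (m + 1) → ℂ)
    (a : Fin (m + 1) → R) (b : R) : R :=
  ev lam (L.bracket a b)

/-- A conformal representation of the `n`-Lie conformal algebra `R`, `n = m + 2`, on a
`ℂ[∂]`-module `M`; `act a v`, with `a = (a^1, …, a^{n-1})`, is
`a^1_{λ_1} ⋯ a^{n-1}_{λ_{n-1}} v ∈ M[λ_1, …, λ_{n-1}]`. -/
structure ConformalRep (L : NLieConformalAlgebra m R) (M : Type*) [AddCommGroup M] [Module ℂ M]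
    [Module ℂ[X] M] [IsScalarTower ℂ ℂ[X] M] where
  /-- The action, with polynomial values. -/
  act : MultilinearMap ℂ (fun _ : Fin (m + 1) => R) (M →ₗ[ℂ] LPoly (Fin (m + 1)) M)
  /-- Sesquilinearity in the arguments from `R`. -/
  act_der_left : ∀ (lam : Fin (m + 1) → ℂ) (a : Fin (m + 1) → R) (v : M) (i : Fin (m + 1)),
    ev lam (act (Function.update a i (der (a i))) v) = -(lam i • ev lam (act a v))
  /-- Sesquilinearity in the argument from `M`. -/
  act_der_right : ∀ (lam : Fin (m + 1) → ℂ) (a : Fin (m + 1) → R) (v : M),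
    ev lam (act a (der v)) = der (ev lam (act a v)) + (∑ i, lam i) • ev lam (act a v)
  /-- Skew-symmetry in neighbouring arguments from `R`. -/
  act_swap : ∀ (lam : Fin (m + 1) → ℂ) (a : Fin (m + 1) → R) (v : M) (i : Fin m),
    ev lam (act a v) =
      -ev (lam ∘ Equiv.swap i.castSucc i.succ) (act (a ∘ Equiv.swap i.castSucc i.succ) v)
  /-- First Filippov identity for the action, for `a^1, …, a^n`, `b = (b^1, …, b^{n-2})`, `lam = (λ_1, …, λ_n)` and
  `mu = (λ_{n+1}, …, λ_{2n-2})`. The index `i` is counted from `0`. -/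
  act_filippov : ∀ (lam : Fin (m + 2) → ℂ) (mu : Fin m → ℂ) (a : Fin (m + 2) → R) (b : Fin m → R)
      (v : M),
    ∑ i : Fin (m + 2), (-1 : ℂ) ^ (m + 1 - (i : ℕ)) •
        ev (fun k => lam (i.succAbove k)) (act (fun k => a (i.succAbove k))
          (ev (Fin.cons (lam i) mu) (act (Fin.cons (a i) b) v))) =
      ev (Fin.cons (∑ i, lam i) mu) (act
        (Fin.cons (L.br (fun k => lam k.castSucc) (fun k => a k.castSucc) (a (Fin.last (m + 1)))) b)
        v)
  /-- Second Filippov identity for the action: the commutator of the actions of `a` (at `λ`) and `b` (at `μ`) is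
  `∑_l b^1_{μ_1} ⋯ [a^1_{λ_1} ⋯ a^{n-1}_{λ_{n-1}} b^l]_{μ_l + λ_1 + ⋯ + λ_{n-1}} ⋯ b^{n-1}_{μ_{n-1}} v`. -/
  act_comm : ∀ (lam mu : Fin (m + 1) → ℂ) (a b : Fin (m + 1) → R) (v : M),
    ev lam (act a (ev mu (act b v))) - ev mu (act b (ev lam (act a v))) =
      ∑ l : Fin (m + 1), ev (Function.update mu l (mu l + ∑ i, lam i))
        (act (Function.update b l (L.br lam a (b l))) v)

/-- The value `a^1_{λ_1} ⋯ a^{n-1}_{λ_{n-1}} v` of the action at a complex point. -/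
def ConformalRep.ac {L : NLieConformalAlgebra m R} {M : Type*} [AddCommGroup M] [Module ℂ M]
    [Module ℂ[X] M] [IsScalarTower ℂ ℂ[X] M] (ρ : ConformalRep L M) (lam : Fin (m + 1) → ℂ)
    (a : Fin (m + 1) → R) (v : M) : M :=
  ev lam (ρ.act a v)

end Algebra

/-- The arguments of a cochain of degree `q = p + 1`: `some (i, j)` stands for `a^i_j` (`p = q - 1`
blocks of `n - 1 = m + 1` entries) and `none` for the last argument `a^{q-1}_n`. The indeterminates
`λ^i_j` and `λ^{q-1}_n` have the same indices. -/
abbrev Slot (m p : ℕ) : Type := Option (Fin p × Fin (m + 1))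

/-- The block of an argument; the last argument belongs to the last block, which thus has `n`
entries. -/
def Slot.block {m p : ℕ} : Slot m p → ℕ
  | some (i, _) => i
  | none => p - 1

/-- The family indexed by `Slot m p` with blocks `x 0, …, x (p - 1)` and last entry `y`. -/
def slots {m p : ℕ} {T : Type*} (x : Fin p → Fin (m + 1) → T) (y : T) : Slot m p → T
  | some (i, j) => x i j
  | none => y

/-- The space of cochains of degree `q = p + 1` of an `n`-Lie conformal algebra on `R`, `n = m + 2`,
with coefficients in `M`: the `ℂ`-multilinear maps from `n - 1` times `q - 1` plus `1` copies of `R`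
to `M[λ^{1→q-1}_{1→n-1}, λ^{q-1}_n]` that satisfy conformal antilinearity in every argument and
skew-symmetry under simultaneous permutations of the entries and the indeterminates of any
one block. -/
def Cochain (m p : ℕ) (R M : Type*) [AddCommGroup R] [Module ℂ R] [Module ℂ[X] R]
    [AddCommGroup M] [Module ℂ M] :
    Submodule ℂ (MultilinearMap ℂ (fun _ : Slot m p => R) (LPoly (Slot m p) M)) where
  carrier := {γ |
    (∀ (lam : Slot m p → ℂ) (a : Slot m p → R) (s : Slot m p),
      ev lam (γ (Function.update a s (der (a s)))) = -(lam s • ev lam (γ a))) ∧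
    (∀ (i : ℕ) (π : Equiv.Perm (Slot m p)), (∀ s, π s ≠ s → s.block = i) →
      ∀ (lam : Slot m p → ℂ) (a : Slot m p → R),
        ev (lam ∘ π) (γ (a ∘ π)) = (((Equiv.Perm.sign π : ℤˣ) : ℤ) : ℂ) • ev lam (γ a))}
  zero_mem' := by simp
  add_mem' := by
    rintro γ δ ⟨h1, h2⟩ ⟨k1, k2⟩
    refine ⟨fun lam a s => ?_, fun i π hπ lam a => ?_⟩
    · simp only [add_apply, map_add, h1, k1, smul_add, neg_add]
    · simp only [add_apply, map_add, h2 i π hπ, k2 i π hπ, smul_add]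
  smul_mem' := by
    rintro c γ ⟨h1, h2⟩
    refine ⟨fun lam a s => ?_, fun i π hπ lam a => ?_⟩
    · simp only [smul_apply, map_smul, h1, smul_neg, smul_comm c]
    · simp only [smul_apply, map_smul, h2 i π hπ, smul_comm c]

section Differential

variable {m p : ℕ} {R : Type*} [AddCommGroup R] [Module ℂ R] [Module ℂ[X] R] [IsScalarTower ℂ ℂ[X] R]
  {M : Type*} [AddCommGroup M] [Module ℂ M] [Module ℂ[X] M] [IsScalarTower ℂ ℂ[X] M]

/-- The value `γ_{λ, μ}(a^1, …, a^{q-1}, z)` of a cochain of degree `q = p + 1`, where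
`a^i = (a^i_1, …, a^i_{n-1})` has the indices `λ^i = (λ^i_1, …, λ^i_{n-1})` and `z` the index `μ`. -/
def val (γ : Cochain m p R M) (lam : Fin p → Fin (m + 1) → ℂ) (mu : ℂ)
    (a : Fin p → Fin (m + 1) → R) (z : R) : M :=
  ev (slots lam mu) (γ.1 (slots a z))

/-- The four-summand expression for `(Dγ)_{λ, μ}(a^1, …, a^q, z)`, for a cochain `γ` of degree
`q = p + 1`. The indices `i`, `j`, `k`, `l` are counted from `0`, so that the exponents `i`, `i`,
`i + 1` and `n + q - i + 1` of the usual form, with indices counted from `1`, are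
`i + 1`, `i + 1`, `i` and `m + p + 3 - k` here. -/
def diffValue {L : NLieConformalAlgebra m R} (ρ : ConformalRep L M) (γ : Cochain m p R M)
    (lam : Fin (p + 1) → Fin (m + 1) → ℂ) (mu : ℂ) (a : Fin (p + 1) → Fin (m + 1) → R) (z : R) :
    M :=
  (∑ i : Fin (p + 1), ∑ j ∈ Finset.univ.filter (fun j : Fin (p + 1) => i < j),
    ∑ l : Fin (m + 1), (-1 : ℂ) ^ ((i : ℕ) + 1) •
      val γ
        (i.removeNth (Function.update lam j
          (Function.update (lam j) l (lam j l + ∑ k, lam i k)))) mu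
        (i.removeNth (Function.update a j
          (Function.update (a j) l (L.br (lam i) (a i) (a j l))))) z)
  + (∑ i : Fin (p + 1), (-1 : ℂ) ^ ((i : ℕ) + 1) •
      val γ (i.removeNth lam) (mu + ∑ k, lam i k) (i.removeNth a) (L.br (lam i) (a i) z))
  + (∑ i : Fin (p + 1), (-1 : ℂ) ^ (i : ℕ) •
      ρ.ac (lam i) (a i) (val γ (i.removeNth lam) mu (i.removeNth a) z))
  + (∑ k : Fin (m + 1), (-1 : ℂ) ^ (m + p + 3 - (k : ℕ)) •
      ρ.ac (Fin.snoc (k.removeNth (lam (Fin.last p))) mu)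
        (Fin.snoc (k.removeNth (a (Fin.last p))) z)
        (val γ (Fin.init lam) (lam (Fin.last p) k) (Fin.init a) (a (Fin.last p) k)))

end Differential

end NLieConformal

end

noncomputable section

set_option linter.unusedSectionVars false

namespace NLieConformal

section

/-! ### Permutations, signs, and the cycle that brings an entry to the last place. -/

section Sign

/-! An argument from `R` and its indeterminate, taken at a complex value, are treated as one pair
(a, λ), so that a cochain becomes a function of families of pairs, admissible (`Adm`) in every
entry. A bracket of n pairs carries the sum of their λ's (`brP`). An admissible function turns ∂
into minus its scalar argument; hence the substitution -∂ - λ_1 - ⋯ - λ_{n-1} in the last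
skew-symmetry axiom becomes the missing λ_n. Seen through admissible functions, pairs therefore
behave like an ordinary n-Lie algebra acting on `M`: see `brP_perm`, `brP_filippov`, `acP_comm` and
`acP_filippov`.

On functions of pairs there is a Cartan calculus. Let ι_x be contraction of the first block with x,
and θ_x the Lie derivative. The differential is defined by the recursion ι_x D = θ_x - D ι_x,
starting from an explicit map `dOne` in degree 1. The commutators [θ_x, θ_y] and [θ_x, ι_y] are the
sums over l of θ and ι at y with y_l replaced by [x, y_l]; they give D θ_x = θ_x D by induction
(`diff_lieDer`). Then ι_x D² = θ_x D - D θ_x + D² ι_x reduces D² = 0 to degree 1. There θ_x f - ι_x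
D f is a combination of functions of u in which x with one entry dropped, followed by u, acts on a
fixed vector. D kills each of them, which is the first Filippov identity of the action (`dOne_act`,
`dOne_dOne`).

The same recursion preserves admissibility, skew-symmetry in the blocks and polynomial dependence on
λ, and it unfolds to the four sums (`fourSum_succ`). Polynomials are determined by their values, so
the resulting functions come from unique cochains. -/

/-- The sign of a permutation as a complex number. -/
def sg {α : Type*} [Fintype α] [DecidableEq α] (π : Equiv.Perm α) : ℂ :=
  ((Equiv.Perm.sign π : ℤˣ) : ℤ)

variable {α : Type*} [Fintype α] [DecidableEq α]

@[simp]
theorem sg_one : sg (1 : Equiv.Perm α) = 1 := by simp [sg]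

theorem sg_mul (π τ : Equiv.Perm α) : sg (π * τ) = sg π * sg τ := by simp [sg]

theorem sg_swap {i j : α} (h : i ≠ j) : sg (Equiv.swap i j) = -1 := by
  simp [sg, Equiv.Perm.sign_swap h]

theorem sg_mul_self (π : Equiv.Perm α) : sg π * sg π = 1 := by
  rw [sg, ← Int.cast_mul, ← Units.val_mul, Int.units_mul_self]; simp

/-- A function of `n + 1` arguments that changes its sign under transpositions of neighbours is
skew-symmetric. -/
theorem skew_of_neighbours {n : ℕ} {S V : Type*} [AddCommGroup V] [Module ℂ V]
    (f : (Fin (n + 1) → S) → V)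
    (h : ∀ (i : Fin n) (w : Fin (n + 1) → S), f (w ∘ Equiv.swap i.castSucc i.succ) = -f w)
    (π : Equiv.Perm (Fin (n + 1))) (w : Fin (n + 1) → S) : f (w ∘ π) = sg π • f w := by
  have hπ : π ∈ Submonoid.closure
      (Set.range fun i : Fin n => Equiv.swap i.castSucc i.succ) := by
    rw [Equiv.Perm.mclosure_swap_castSucc_succ]; trivial
  induction hπ using Submonoid.closure_induction generalizing w with
  | mem x hx =>
    obtain ⟨i, rfl⟩ := hx
    simp only
    rw [h, sg_swap (Fin.castSucc_lt_succ).ne]; simp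
  | one => simp
  | mul x y _ _ hx hy =>
    rw [Equiv.Perm.coe_mul, ← Function.comp_assoc, hy, hx, sg_mul, smul_smul, mul_comm]

/-- A function on families that changes its sign under transpositions within a set of indices is
skew-symmetric under the permutations supported in that set. -/
theorem skew_of_swap {S V : Type*} [AddCommGroup V] [Module ℂ V]
    (f : (α → S) → V) (T : α → Prop)
    (h : ∀ s t, s ≠ t → T s → T t → ∀ w : α → S, f (w ∘ Equiv.swap s t) = -f w)
    (π : Equiv.Perm α) (hπ : ∀ s, π s ≠ s → T s) (w : α → S) : f (w ∘ π) = sg π • f w := by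
  classical
  have key : ∀ τ : Equiv.Perm {s // T s}, ∀ w : α → S,
      f (w ∘ Equiv.Perm.ofSubtype τ) = sg (Equiv.Perm.ofSubtype τ) • f w := by
    intro τ
    induction τ using Equiv.Perm.swap_induction_on with
    | one => simp
    | swap_mul τ x y hxy ih =>
      intro w
      have hne : (x : α) ≠ y := fun h' => hxy (Subtype.ext h')
      rw [map_mul, Equiv.Perm.ofSubtype_swap_eq, Equiv.Perm.coe_mul, ← Function.comp_assoc, ih,
        h _ _ hne x.2 y.2, sg_mul, sg_swap hne]
      simp
  have hT : ∀ x, T (π x) ↔ T x := by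
    intro x
    by_cases hx : π x = x
    · rw [hx]
    · exact ⟨fun _ => hπ x hx, fun _ => hπ _ fun h' => hx (π.injective h')⟩
  have := key (π.subtypePerm hT) w
  rwa [Equiv.Perm.ofSubtype_subtypePerm hT hπ] at this

/-- The cycle that moves the last index to the place `k`. -/
def toLast {n : ℕ} (k : Fin (n + 1)) : Equiv.Perm (Fin (n + 1)) := Fin.cycleIcc k (Fin.last n)

@[simp]
theorem toLast_last {n : ℕ} (k : Fin (n + 1)) : toLast k (Fin.last n) = k :=
  Fin.cycleIcc_of_last (Fin.le_last k)

@[simp]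
theorem toLast_castSucc {n : ℕ} (k : Fin (n + 1)) (j : Fin n) :
    toLast k j.castSucc = k.succAbove j := by
  rcases lt_or_ge j.castSucc k with h | h
  · rw [toLast, Fin.cycleIcc_of_lt h, Fin.succAbove_of_castSucc_lt _ _ h]
  · rw [toLast, Fin.cycleIcc_of_ge_of_lt h (Fin.castSucc_lt_last j),
      Fin.succAbove_of_le_castSucc _ _ h, Fin.coeSucc_eq_succ]

theorem sg_toLast {n : ℕ} (k : Fin (n + 1)) : sg (toLast k) = (-1) ^ (n - (k : ℕ)) := by
  rw [sg, toLast, Fin.sign_cycleIcc_of_le (Fin.le_last k)]; simp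

theorem comp_toLast {n : ℕ} {S : Type*} (w : Fin (n + 1) → S) (k : Fin (n + 1)) :
    w ∘ toLast k = Fin.snoc (α := fun _ => S) (k.removeNth w) (w k) := by
  funext j
  induction j using Fin.lastCases with
  | last => simp
  | cast j => simp [Fin.removeNth_apply]

theorem removeNth_castSucc_snoc {n : ℕ} {S : Type*} (x : Fin (n + 1) → S) (z : S)
    (k : Fin (n + 1)) :
    k.castSucc.removeNth (Fin.snoc (α := fun _ => S) x z) =
      Fin.snoc (α := fun _ => S) (k.removeNth x) z := by
  funext j
  induction j using Fin.lastCases with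
  | last => simp [Fin.removeNth_apply]
  | cast j => simp [Fin.removeNth_apply]

theorem cons_castSucc_map {n : ℕ} {S T : Type*} (φ : S → T) (u : S) (x : Fin (n + 1) → S) :
    (fun k : Fin (n + 1) => φ (Fin.cons (α := fun _ => S) u x k.castSucc)) =
      Fin.cons (α := fun _ => T) (φ u) fun k : Fin n => φ (x k.castSucc) := by
  funext k
  induction k using Fin.cases <;> simp

end Sign

/-! ### Admissible functions and the n-Lie algebra of pairs. -/

variable {m : ℕ} {R : Type*} [AddCommGroup R] [Module ℂ R] [Module ℂ[X] R] [IsScalarTower ℂ ℂ[X] R]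
  {M : Type*} [AddCommGroup M] [Module ℂ M]

/-- The functions `f` of `(a, λ)` that are linear in `a` and satisfy `f(∂a, λ) = -λ f(a, λ)`. -/
def Adm (R M : Type*) [AddCommGroup R] [Module ℂ R] [Module ℂ[X] R] [AddCommGroup M]
    [Module ℂ M] : Submodule ℂ (R × ℂ → M) where
  carrier := {f | ∀ l : ℂ, (∀ a b, f (a + b, l) = f (a, l) + f (b, l)) ∧
    (∀ (c : ℂ) a, f (c • a, l) = c • f (a, l)) ∧ ∀ a, f (der a, l) = -(l • f (a, l))}
  zero_mem' := by simp
  add_mem' := by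
    intro f g hf hg l
    obtain ⟨f1, f2, f3⟩ := hf l
    obtain ⟨g1, g2, g3⟩ := hg l
    refine ⟨fun a b => ?_, fun c a => ?_, fun a => ?_⟩
    · simp only [Pi.add_apply, f1, g1]; abel
    · simp only [Pi.add_apply, f2, g2, smul_add]
    · simp only [Pi.add_apply, f3, g3, smul_add]; abel
  smul_mem' := by
    intro c f hf l
    obtain ⟨f1, f2, f3⟩ := hf l
    refine ⟨fun a b => ?_, fun c a => ?_, fun a => ?_⟩
    · simp only [Pi.smul_apply, f1, smul_add]
    · simp only [Pi.smul_apply, f2, smul_comm c]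
    · simp only [Pi.smul_apply, f3, smul_neg, smul_comm c]

/-- An admissible function as a linear map, for a fixed second argument. -/
def Adm.lin {f : R × ℂ → M} (hf : f ∈ Adm R M) (l : ℂ) : R →ₗ[ℂ] M where
  toFun a := f (a, l)
  map_add' := (hf l).1
  map_smul' := (hf l).2.1

@[simp]
theorem Adm.lin_apply {f : R × ℂ → M} (hf : f ∈ Adm R M) (l : ℂ) (a : R) :
    Adm.lin hf l a = f (a, l) := rfl

theorem Adm.comp {N : Type*} [AddCommGroup N] [Module ℂ N] {f : R × ℂ → M} (hf : f ∈ Adm R M)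
    (φ : M →ₗ[ℂ] N) : (fun u => φ (f u)) ∈ Adm R N := by
  intro l
  obtain ⟨h1, h2, h3⟩ := hf l
  exact ⟨fun a b => by simp only [h1, map_add], fun c a => by simp only [h2, map_smul],
    fun a => by simp only [h3, map_neg, map_smul]⟩

theorem Adm.polynomial_smul {f : R × ℂ → M} (hf : f ∈ Adm R M) (l : ℂ) (Q : ℂ[X]) (a : R) :
    f (Q • a, l) = Q.eval (-l) • f (a, l) := by
  induction Q using Polynomial.induction_on' generalizing a with
  | add p q hp hq => rw [add_smul, (hf l).1, hp, hq, Polynomial.eval_add, add_smul]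
  | monomial k c =>
    induction k generalizing a with
    | zero =>
      have : (Polynomial.monomial 0 c : ℂ[X]) • a = c • a := by
        rw [Polynomial.monomial_zero_left, ← mul_one (Polynomial.C c), ← Polynomial.smul_eq_C_mul,
          smul_assoc, one_smul]
      rw [this, (hf l).2.1]; simp
    | succ k ih =>
      have : (Polynomial.monomial (k + 1) c : ℂ[X]) • a = Polynomial.monomial k c • der a := by
        rw [der, smul_smul, Polynomial.monomial_mul_X]
      rw [this, ih, (hf l).2.2]
      simp only [Polynomial.eval_monomial, pow_succ, smul_smul, ← neg_smul]
      ring_nf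

/-- Powers of ∂ placed on the left become powers of -l under an admissible function, so substituting
elements of ℂ[∂] for the indeterminates becomes evaluation at a complex point. -/
theorem Adm.evDer {σ : Type*} {f : R × ℂ → M} (hf : f ∈ Adm R M) (l : ℂ) (s : σ → ℂ[X])
    (P : LPoly σ R) :
    f (NLieConformal.evDer s P, l) = f (ev (fun k => (s k).eval (-l)) P, l) := by
  induction P using TensorProduct.induction_on with
  | zero => simp
  | tmul P v =>
    rw [evDer_tmul, Adm.polynomial_smul hf, ev_tmul, (hf l).2.1]
    congr 1
    induction P using MvPolynomial.induction_on with
    | C c => simp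
    | add p q hp hq => simp [hp, hq]
    | mul_X p i hp => simp [hp]
  | add x y hx hy => simp only [map_add, (hf l).1, hx, hy]

/-- The bracket of `n` pairs `(a^i, λ_i)`, with the sum of the `λ_i` attached. -/
def brP (L : NLieConformalAlgebra m R) (w : Fin (m + 2) → R × ℂ) : R × ℂ :=
  (L.br (fun k => (w k.castSucc).2) (fun k => (w k.castSucc).1) (w (Fin.last (m + 1))).1,
    ∑ k, (w k).2)

variable (L : NLieConformalAlgebra m R)

/-- Among the first n - 1 entries this is an axiom. For the last two it needs f: the axiom involves
∂, which only f replaces by a number. -/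
theorem brP_swap {f : R × ℂ → M} (hf : f ∈ Adm R M) (i : Fin (m + 1)) (w : Fin (m + 2) → R × ℂ) :
    f (brP L (w ∘ Equiv.swap i.castSucc i.succ)) = -f (brP L w) := by
  have hs : ∑ k, ((w ∘ Equiv.swap i.castSucc i.succ) k).2 = ∑ k, (w k).2 :=
    Equiv.sum_comp (Equiv.swap i.castSucc i.succ) fun k => (w k).2
  rw [brP, brP, hs]
  simp only [← Adm.lin_apply hf]
  rw [← map_neg]
  simp only [Adm.lin_apply]
  induction i using Fin.lastCases with
  | last =>
    have h := L.bracket_swap_last (fun k => (w k.castSucc).2) (fun k => (w k.castSucc).1)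
      (w (Fin.last (m + 1))).1
    -- Here ∂ becomes minus the sum of all n indeterminates, so the substituted -∂ - λ_1 - ⋯ -
    -- λ_{n-1} takes the value λ_n.
    rw [NLieConformalAlgebra.br, NLieConformalAlgebra.br, h, neg_neg, Adm.evDer hf]
    have e1 : (fun k : Fin (m + 1) =>
        ((w ∘ Equiv.swap (Fin.last m).castSucc (Fin.last m).succ) k.castSucc).1) =
        Function.update (fun k : Fin (m + 1) => (w k.castSucc).1) (Fin.last m)
          (w (Fin.last (m + 1))).1 := by
      funext k
      induction k using Fin.lastCases with
      | last => simp
      | cast k =>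
        have h1 : k.castSucc ≠ Fin.last m := (Fin.castSucc_lt_last k).ne
        rw [Function.update_of_ne h1, Function.comp_apply, Equiv.swap_apply_of_ne_of_ne]
        · exact fun h' => h1 (Fin.castSucc_injective _ h')
        · rw [Fin.succ_last]; exact (Fin.castSucc_lt_last _).ne
    have e2 : (fun k : Fin (m + 1) =>
        ((w ∘ Equiv.swap (Fin.last m).castSucc (Fin.last m).succ) k.castSucc).2) =
        fun k => Polynomial.eval (-∑ k, (w k).2)
          (Function.update (fun i : Fin (m + 1) => Polynomial.C (w i.castSucc).2) (Fin.last m)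
            (-Polynomial.X - Polynomial.C (∑ i : Fin (m + 1), (w i.castSucc).2)) k) := by
      funext k
      induction k using Fin.lastCases with
      | last =>
        simp [Fin.sum_univ_castSucc (n := m + 1), Polynomial.eval_finsetSum]
      | cast k =>
        have h1 : k.castSucc ≠ Fin.last m := (Fin.castSucc_lt_last k).ne
        rw [Function.update_of_ne h1, Function.comp_apply, Equiv.swap_apply_of_ne_of_ne]
        · simp
        · exact fun h' => h1 (Fin.castSucc_injective _ h')
        · rw [Fin.succ_last]; exact (Fin.castSucc_lt_last _).ne
    have e3 : ((w ∘ Equiv.swap (Fin.last m).castSucc (Fin.last m).succ) (Fin.last (m + 1))).1 =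
        (w (Fin.last m).castSucc).1 := by
      rw [Function.comp_apply, Fin.succ_last, Equiv.swap_apply_right]
    rw [e1, e2, e3]
  | cast i =>
    have h := L.bracket_swap (fun k => (w k.castSucc).2) (fun k => (w k.castSucc).1)
      (w (Fin.last (m + 1))).1 i
    rw [NLieConformalAlgebra.br, NLieConformalAlgebra.br, h, neg_neg]
    have e : ∀ k : Fin (m + 1), Equiv.swap i.castSucc.castSucc i.castSucc.succ k.castSucc =
        (Equiv.swap i.castSucc i.succ k).castSucc := by
      intro k
      rw [Fin.succ_castSucc]
      exact Fin.castSucc_injective _ |>.swap_apply _ _ _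
    have e' : Equiv.swap i.castSucc.castSucc i.castSucc.succ (Fin.last (m + 1)) =
        Fin.last (m + 1) := by
      rw [Equiv.swap_apply_of_ne_of_ne]
      · exact (Fin.castSucc_lt_last _).ne'
      · rw [Fin.succ_castSucc]; exact (Fin.castSucc_lt_last _).ne'
    simp only [Function.comp_apply, e, e']
    rfl

theorem brP_perm {f : R × ℂ → M} (hf : f ∈ Adm R M) (π : Equiv.Perm (Fin (m + 2)))
    (w : Fin (m + 2) → R × ℂ) : f (brP L (w ∘ π)) = sg π • f (brP L w) :=
  skew_of_neighbours (fun w => f (brP L w)) (brP_swap L hf) π w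

/-- The factor ∂ + λ_1 + ⋯ + λ_{n-1} from the bracket becomes -λ_n, because f reads ∂ as minus the
total sum attached to the bracket. -/
theorem Adm.brP_snoc {f : R × ℂ → M} (hf : f ∈ Adm R M) (x : Fin (m + 1) → R × ℂ) :
    (fun u => f (brP L (Fin.snoc x u))) ∈ Adm R M := by
  intro l
  have hb : ∀ a : R, brP L (Fin.snoc (α := fun _ => R × ℂ) x (a, l)) =
      (L.br (fun k => (x k).2) (fun k => (x k).1) a, (∑ k, (x k).2) + l) := by
    intro a
    simp [brP, Fin.sum_univ_castSucc (n := m + 1)]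
  simp only [hb]
  refine ⟨fun a b => ?_, fun c a => ?_, fun a => ?_⟩
  · simp only [NLieConformalAlgebra.br, map_add, (hf _).1]
  · simp only [NLieConformalAlgebra.br, map_smul, (hf _).2.1]
  · simp only [NLieConformalAlgebra.br, L.bracket_der_right, (hf _).1, (hf _).2.1, (hf _).2.2]
    rw [← neg_smul, ← neg_smul, ← add_smul]
    ring_nf

theorem Adm.brP_update {f : R × ℂ → M} (hf : f ∈ Adm R M) (w : Fin (m + 2) → R × ℂ)
    (s : Fin (m + 2)) : (fun u => f (brP L (Function.update w s u))) ∈ Adm R M := by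
  have h : (fun u => f (brP L (Function.update w s u))) =
      sg (toLast s) • fun u => f (brP L (Fin.snoc (s.removeNth w) u)) := by
    funext u
    have := comp_toLast (Function.update w s u) s
    rw [Fin.removeNth_update, Function.update_self] at this
    rw [Pi.smul_apply, ← this, brP_perm L hf, smul_smul, sg_mul_self, one_smul]
  rw [h]
  exact Submodule.smul_mem _ _ (Adm.brP_snoc L hf _)

/-- The Filippov identity: the bracket with `n - 1` fixed arguments is a derivation. -/
theorem brP_filippov {f : R × ℂ → M} (hf : f ∈ Adm R M) (x : Fin (m + 1) → R × ℂ)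
    (W : Fin (m + 2) → R × ℂ) :
    f (brP L (Fin.snoc x (brP L W))) =
      ∑ s, f (brP L (Function.update W s (brP L (Fin.snoc x (W s))))) := by
  have hc : ∀ {g : R × ℂ → M}, g ∈ Adm R M → ∀ u : R × ℂ,
      g (brP L (Fin.snoc (α := fun _ => R × ℂ) x u)) =
        sg (toLast (0 : Fin (m + 2))) • g (brP L (Fin.cons (α := fun _ => R × ℂ) u x)) := by
    intro g hg u
    have := comp_toLast (Fin.cons (α := fun _ => R × ℂ) u x) 0
    rw [Fin.removeNth_zero, Fin.tail_cons, Fin.cons_zero] at this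
    rw [← this, brP_perm L hg]
  have hs : ∀ s u, f (brP L (Function.update W s u)) =
      sg (toLast s) • f (brP L (Fin.snoc (α := fun _ => R × ℂ) (s.removeNth W) u)) := by
    intro s u
    have := comp_toLast (Function.update W s u) s
    rw [Fin.removeNth_update, Function.update_self] at this
    rw [← this, brP_perm L hf, smul_smul, sg_mul_self, one_smul]
  have hlast : ∀ u : R × ℂ, Fin.cons (α := fun _ => R × ℂ) u x (Fin.last (m + 1)) =
      x (Fin.last m) := fun u => by rw [← Fin.succ_last, Fin.cons_succ]
  -- This is the axiom in its own form, with the inner bracket in first place; `hc` and `hs` then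
  -- move brackets to the places wanted. The sign from `hc` is the same on both sides.
  have key : f (brP L (Fin.cons (α := fun _ => R × ℂ) (brP L W) x)) =
      ∑ s, sg (toLast s) • f (brP L (Fin.snoc (α := fun _ => R × ℂ) (s.removeNth W)
        (brP L (Fin.cons (α := fun _ => R × ℂ) (W s) x)))) := by
    have hb : ∀ u : R × ℂ, brP L (Fin.cons (α := fun _ => R × ℂ) u x) =
        (ev (Fin.cons u.2 fun k : Fin m => (x k.castSucc).2) (L.bracket
          (Fin.cons u.1 fun k : Fin m => (x k.castSucc).1) (x (Fin.last m)).1),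
          u.2 + ∑ i, (x i).2) := by
      intro u
      rw [brP, Fin.sum_univ_succ, NLieConformalAlgebra.br, cons_castSucc_map Prod.snd,
        cons_castSucc_map Prod.fst, hlast]
      rfl
    have hr : ∀ s, brP L (Fin.snoc (α := fun _ => R × ℂ) (s.removeNth W)
        (brP L (Fin.cons (α := fun _ => R × ℂ) (W s) x))) =
        (ev (fun k => (W (s.succAbove k)).2) (L.bracket (fun k => (W (s.succAbove k)).1)
          (ev (Fin.cons (W s).2 fun k : Fin m => (x k.castSucc).2) (L.bracket
            (Fin.cons (W s).1 fun k : Fin m => (x k.castSucc).1) (x (Fin.last m)).1))),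
          ∑ i, (W i).2 + ∑ i, (x i).2) := by
      intro s
      rw [hb, brP, Fin.sum_univ_castSucc (n := m + 1), Fin.snoc_last]
      simp only [Fin.snoc_castSucc, Fin.removeNth_apply]
      refine Prod.ext rfl ?_
      rw [Fin.sum_univ_succAbove (fun i => (W i).2) s]
      ring
    have h := L.filippov (fun k => (W k).2) (fun k => (x k.castSucc).2) (fun k => (W k).1)
      (fun k => (x k.castSucc).1) (x (Fin.last m)).1
    rw [hb (brP L W), brP, NLieConformalAlgebra.br, ← h]
    simp only [hr, sg_toLast]
    simp only [← Adm.lin_apply hf, map_sum, map_smul]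
  rw [hc hf, key, Finset.smul_sum]
  refine Finset.sum_congr rfl fun s _ => ?_
  rw [hs, hc (Adm.brP_snoc L hf _), smul_comm]

/-- The derivation property applied to the bracket of y and u: the summand at the last entry is the
second double bracket. -/
theorem brP_comm {f : R × ℂ → M} (hf : f ∈ Adm R M) (x y : Fin (m + 1) → R × ℂ) (u : R × ℂ) :
    f (brP L (Fin.snoc x (brP L (Fin.snoc y u)))) - f (brP L (Fin.snoc y (brP L (Fin.snoc x u)))) =
      ∑ l, f (brP L (Fin.snoc (Function.update y l (brP L (Fin.snoc x (y l)))) u)) := by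
  rw [brP_filippov L hf x, Fin.sum_univ_castSucc, Fin.snoc_last, Fin.update_snoc_last,
    add_sub_cancel_right]
  simp only [Fin.snoc_castSucc, Fin.snoc_update]

end

/-! ### The action of pairs and the Lie derivative. -/

section

variable {m : ℕ} {R : Type*} [AddCommGroup R] [Module ℂ R] [Module ℂ[X] R] [IsScalarTower ℂ ℂ[X] R]
  {M : Type*} [AddCommGroup M] [Module ℂ M] [Module ℂ[X] M] [IsScalarTower ℂ ℂ[X] M]
  {L : NLieConformalAlgebra m R} (ρ : ConformalRep L M)

/-- The action of `n - 1` pairs `(a^i, λ_i)` as a linear map. -/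
def acP (x : Fin (m + 1) → R × ℂ) : M →ₗ[ℂ] M :=
  (ev fun k => (x k).2).comp (ρ.act fun k => (x k).1)

theorem acP_apply (x : Fin (m + 1) → R × ℂ) (v : M) :
    acP ρ x v = ρ.ac (fun k => (x k).2) (fun k => (x k).1) v := rfl

theorem acP_perm (π : Equiv.Perm (Fin (m + 1))) (x : Fin (m + 1) → R × ℂ) (v : M) :
    acP ρ (x ∘ π) v = sg π • acP ρ x v := by
  refine skew_of_neighbours (fun x => acP ρ x v) (fun i x => ?_) π x
  have := ρ.act_swap (fun k => (x k).2) (fun k => (x k).1) v i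
  rw [acP_apply ρ x, ConformalRep.ac, this, neg_neg]
  rfl

theorem Adm.acP_update (x : Fin (m + 1) → R × ℂ) (s : Fin (m + 1)) (v : M) :
    (fun u => acP ρ (Function.update x s u) v) ∈ Adm R M := by
  intro l
  have hb : ∀ a : R, acP ρ (Function.update x s (a, l)) v =
      ev (Function.update (fun k => (x k).2) s l)
        (ρ.act (Function.update (fun k => (x k).1) s a) v) := by
    intro a
    rw [acP_apply, ConformalRep.ac]
    congr 1
    · congr 1
      funext k
      by_cases h : k = s
      · subst h; simp
      · simp [h]
    · congr 2
      funext k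
      by_cases h : k = s
      · subst h; simp
      · simp [h]
  simp only [hb]
  refine ⟨fun a b => ?_, fun c a => ?_, fun a => ?_⟩
  · rw [MultilinearMap.map_update_add, LinearMap.add_apply, map_add]
  · rw [MultilinearMap.map_update_smul, LinearMap.smul_apply, map_smul]
  · have := ρ.act_der_left (Function.update (fun k => (x k).2) s l)
      (Function.update (fun k => (x k).1) s a) v s
    simpa using this

theorem acP_comm (x y : Fin (m + 1) → R × ℂ) (v : M) :
    acP ρ x (acP ρ y v) - acP ρ y (acP ρ x v) =
      ∑ l, acP ρ (Function.update y l (brP L (Fin.snoc x (y l)))) v := by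
  have h := ρ.act_comm (fun k => (x k).2) (fun k => (y k).2) (fun k => (x k).1)
    (fun k => (y k).1) v
  refine h.trans (Finset.sum_congr rfl fun l _ => ?_)
  rw [acP_apply, ConformalRep.ac]
  congr 1
  · congr 1
    funext k
    by_cases h : k = l
    · subst h; simp [brP, Fin.sum_univ_castSucc (n := m + 1), add_comm]
    · simp [h]
  · congr 2
    funext k
    by_cases h : k = l
    · subst h; simp [brP]
    · simp [h]

theorem acP_filippov (W : Fin (m + 2) → R × ℂ) (b : Fin m → R × ℂ) (v : M) :
    ∑ i, sg (toLast i) • acP ρ (i.removeNth W) (acP ρ (Fin.cons (W i) b) v) =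
      acP ρ (Fin.cons (brP L W) b) v := by
  have hc : ∀ u : R × ℂ, acP ρ (Fin.cons (α := fun _ => R × ℂ) u b) v =
      ev (Fin.cons u.2 fun k => (b k).2) (ρ.act (Fin.cons u.1 fun k => (b k).1) v) := by
    intro u
    rw [acP_apply, ConformalRep.ac]
    congr 1
    · congr 1
      funext k
      induction k using Fin.cases <;> simp
    · congr 2
      funext k
      induction k using Fin.cases <;> simp
  have h := ρ.act_filippov (fun k => (W k).2) (fun k => (b k).2) (fun k => (W k).1)
    (fun k => (b k).1) v
  rw [hc, brP, ← h]
  refine Finset.sum_congr rfl fun i _ => ?_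
  rw [sg_toLast, hc]
  rfl

section Lie

variable {σ : Type*} [Fintype σ] [DecidableEq σ]

/-- The functions of families of pairs that are admissible in every entry. -/
def SlotAdm (γ : (σ → R × ℂ) → M) : Prop :=
  ∀ X s, (fun u => γ (Function.update X s u)) ∈ Adm R M

/-- The Lie derivative along `x` of functions of families of pairs. -/
def lieDer (x : Fin (m + 1) → R × ℂ) :
    ((σ → R × ℂ) → M) →ₗ[ℂ] ((σ → R × ℂ) → M) where
  toFun γ X := acP ρ x (γ X) - ∑ s, γ (Function.update X s (brP L (Fin.snoc x (X s))))
  map_add' γ δ := by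
    funext X
    simp only [Pi.add_apply, map_add, Finset.sum_add_distrib]
    abel
  map_smul' c γ := by
    funext X
    simp only [Pi.smul_apply, map_smul, ← Finset.smul_sum, ← smul_sub, RingHom.id_apply]

theorem lieDer_apply (x : Fin (m + 1) → R × ℂ) (γ : (σ → R × ℂ) → M) (X : σ → R × ℂ) :
    lieDer ρ x γ X =
      acP ρ x (γ X) - ∑ s, γ (Function.update X s (brP L (Fin.snoc x (X s)))) := rfl

/-- Terms with one bracket and one action cancel, as do terms with brackets in two different
entries. The commutator of the actions (`acP_comm`) and the two brackets in the same entry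
(`brP_comm`) remain. -/
theorem lieDer_comm {γ : (σ → R × ℂ) → M} (hγ : SlotAdm γ) (x y : Fin (m + 1) → R × ℂ)
    (X : σ → R × ℂ) :
    lieDer ρ x (lieDer ρ y γ) X - lieDer ρ y (lieDer ρ x γ) X =
      ∑ l, lieDer ρ (Function.update y l (brP L (Fin.snoc x (y l)))) γ X := by
  have hA : ∀ x y : Fin (m + 1) → R × ℂ, ∀ s t, s ≠ t →
      γ (Function.update (Function.update X s (brP L (Fin.snoc x (X s)))) t (brP L (Fin.snoc y
        (Function.update X s (brP L (Fin.snoc x (X s))) t)))) =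
      γ (Function.update (Function.update X t (brP L (Fin.snoc y (X t)))) s (brP L (Fin.snoc x
        (Function.update X t (brP L (Fin.snoc y (X t))) s)))) := by
    intro x y s t hst
    rw [Function.update_of_ne hst.symm, Function.update_of_ne hst, Function.update_comm hst]
  have hdouble : ∑ s, ∑ t, γ (Function.update (Function.update X s (brP L (Fin.snoc x (X s)))) t
        (brP L (Fin.snoc y (Function.update X s (brP L (Fin.snoc x (X s))) t)))) -
      ∑ s, ∑ t, γ (Function.update (Function.update X s (brP L (Fin.snoc y (X s)))) t
        (brP L (Fin.snoc x (Function.update X s (brP L (Fin.snoc y (X s))) t)))) =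
      -∑ l, ∑ s, γ (Function.update X s
        (brP L (Fin.snoc (Function.update y l (brP L (Fin.snoc x (y l)))) (X s)))) := by
    rw [Finset.sum_comm (s := Finset.univ (α := Fin (m + 1))), ← Finset.sum_neg_distrib]
    -- Interchanging the sums pairs the term (s, t) of one double sum with (t, s) of the other, so
    -- that off-diagonal terms cancel by `hA`.
    conv_lhs => rw [Finset.sum_comm (f := fun s t => γ (Function.update (Function.update X s
      (brP L (Fin.snoc y (X s)))) t (brP L (Fin.snoc x (Function.update X s
        (brP L (Fin.snoc y (X s))) t)))))]
    rw [← Finset.sum_sub_distrib]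
    refine Finset.sum_congr rfl fun s _ => ?_
    rw [← Finset.sum_sub_distrib, Finset.sum_eq_single s
      (fun t _ hts => by rw [hA x y s t hts.symm, sub_self]) (by simp)]
    simp only [Function.update_self, Function.update_idem]
    rw [← brP_comm L (hγ X s), neg_sub]
  simp only [lieDer_apply, map_sub, map_sum, Finset.sum_sub_distrib, ← acP_comm, ← neg_eq_iff_eq_neg.mpr hdouble]
  abel

end Lie

end

/-! ### Splitting off the first block of a family. -/

section

section Slots

variable {m p : ℕ} {S : Type*}

/-- The arguments other than those of the first block. -/
def Slot.shift : Slot m p → Slot m (p + 1)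
  | some (i, j) => some (i.succ, j)
  | none => none

/-- The first block of a family. -/
def headS (X : Slot m (p + 1) → S) : Fin (m + 1) → S := fun j => X (some (0, j))

/-- A family without its first block. -/
def tailS (X : Slot m (p + 1) → S) : Slot m p → S := fun s => X s.shift

/-- The family with the first block `x` and the remaining entries `Y`. -/
def consS (x : Fin (m + 1) → S) (Y : Slot m p → S) : Slot m (p + 1) → S
  | some (i, j) => Fin.cases (x j) (fun i' => Y (some (i', j))) i
  | none => Y none

@[simp]
theorem consS_zero (x : Fin (m + 1) → S) (Y : Slot m p → S) (j : Fin (m + 1)) :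
    consS x Y (some (0, j)) = x j := rfl

@[simp]
theorem consS_shift (x : Fin (m + 1) → S) (Y : Slot m p → S) (s : Slot m p) :
    consS x Y s.shift = Y s := by
  rcases s with _ | ⟨i, j⟩ <;> rfl

@[simp]
theorem headS_consS (x : Fin (m + 1) → S) (Y : Slot m p → S) : headS (consS x Y) = x := rfl

@[simp]
theorem tailS_consS (x : Fin (m + 1) → S) (Y : Slot m p → S) : tailS (consS x Y) = Y :=
  funext fun s => consS_shift x Y s

theorem Slot.cases_shift {P : Slot m (p + 1) → Prop} (h0 : ∀ j, P (some (0, j)))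
    (hs : ∀ s : Slot m p, P s.shift) (s : Slot m (p + 1)) : P s := by
  rcases s with _ | ⟨i, j⟩
  · exact hs none
  · induction i using Fin.cases with
    | zero => exact h0 j
    | succ i => exact hs (some (i, j))

theorem consS_headS_tailS (X : Slot m (p + 1) → S) : consS (headS X) (tailS X) = X :=
  funext fun s => Slot.cases_shift (P := fun s => consS (headS X) (tailS X) s = X s)
    (fun _ => rfl) (fun s => consS_shift _ _ s) s

theorem Slot.shift_injective : Function.Injective (Slot.shift : Slot m p → Slot m (p + 1)) := by
  rintro (_ | ⟨i, j⟩) (_ | ⟨i', j'⟩) h <;> simp_all [Slot.shift]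

theorem Slot.shift_ne_zero (s : Slot m p) (j : Fin (m + 1)) : s.shift ≠ some (0, j) := by
  rcases s with _ | ⟨i, j⟩ <;> simp [Slot.shift]

theorem consS_update_tail (x : Fin (m + 1) → S) (Y : Slot m p → S) (s : Slot m p) (u : S) :
    consS x (Function.update Y s u) = Function.update (consS x Y) s.shift u := by
  funext t
  induction t using Slot.cases_shift with
  | h0 j => rw [Function.update_of_ne (Slot.shift_ne_zero s j).symm]; rfl
  | hs t =>
    by_cases h : t = s
    · subst h; simp
    · rw [Function.update_of_ne (Slot.shift_injective.ne h)]; simp [h]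

theorem consS_update_head (x : Fin (m + 1) → S) (Y : Slot m p → S) (j : Fin (m + 1)) (u : S) :
    consS (Function.update x j u) Y = Function.update (consS x Y) (some (0, j)) u := by
  funext t
  induction t using Slot.cases_shift with
  | h0 k =>
    by_cases h : k = j
    · subst h; simp
    · rw [Function.update_of_ne (by simpa using h)]; simp [h]
  | hs t => rw [Function.update_of_ne (Slot.shift_ne_zero t j)]; simp

theorem sum_slot_succ {V : Type*} [AddCommMonoid V] (F : Slot m (p + 1) → V) :
    ∑ s, F s = ∑ j, F (some (0, j)) + ∑ s : Slot m p, F s.shift := by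
  simp only [Fintype.sum_option, Fintype.sum_prod_type, Fin.sum_univ_succ (n := p)]
  rw [add_left_comm]
  rfl

theorem slots_cons (x : Fin (p + 1) → Fin (m + 1) → S) (z : S) :
    slots x z = consS (x 0) (slots (Fin.tail x) z) := by
  funext t
  induction t using Slot.cases_shift with
  | h0 k => rfl
  | hs t => rcases t with _ | ⟨i, j⟩ <;> rfl

/-- The entries of a family with one block, in their order. -/
def flatEquiv (m : ℕ) : Fin (m + 2) ≃ Slot m 1 :=
  finSuccEquivLast.trans (Equiv.optionCongr (Equiv.uniqueProd (Fin (m + 1)) (Fin 1)).symm)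

theorem comp_flatEquiv (X : Slot m 1 → S) :
    X ∘ flatEquiv m = Fin.snoc (α := fun _ => S) (headS X) (X none) := by
  funext j
  induction j using Fin.lastCases with
  | last => simp [flatEquiv]; rfl
  | cast j => simp [flatEquiv, headS]; rfl

end Slots

/-! ### The differential in degree 1. -/

variable {m : ℕ} {R : Type*} [AddCommGroup R] [Module ℂ R] [Module ℂ[X] R] [IsScalarTower ℂ ℂ[X] R]
  {M : Type*} [AddCommGroup M] [Module ℂ M] [Module ℂ[X] M] [IsScalarTower ℂ ℂ[X] M]
  {L : NLieConformalAlgebra m R} (ρ : ConformalRep L M)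

/-- The differential of cochains of degree `1`. -/
def dOne : (R × ℂ → M) →ₗ[ℂ] ((Fin (m + 2) → R × ℂ) → M) where
  toFun f w := -f (brP L w) + ∑ k, sg (toLast k) • acP ρ (k.removeNth w) (f (w k))
  map_add' f g := by
    funext w
    simp only [Pi.add_apply, map_add, Finset.sum_add_distrib, smul_add]
    abel
  map_smul' c f := by
    funext w
    simp only [Pi.smul_apply, map_smul, smul_add, Finset.smul_sum, RingHom.id_apply, smul_neg,
      smul_comm c]

theorem dOne_apply (f : R × ℂ → M) (w : Fin (m + 2) → R × ℂ) :
    dOne ρ f w = -f (brP L w) + ∑ k, sg (toLast k) • acP ρ (k.removeNth w) (f (w k)) := rfl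

/-- The k-th action term is a fixed function of w with its k-th entry moved last, and this function
is skew in all entries but the last. A permutation sends these terms to one another up to a
permutation fixing the last place. -/
theorem dOne_perm {f : R × ℂ → M} (hf : f ∈ Adm R M) (π : Equiv.Perm (Fin (m + 2)))
    (w : Fin (m + 2) → R × ℂ) : dOne ρ f (w ∘ π) = sg π • dOne ρ f w := by
  have hG : ∀ σ : Equiv.Perm (Fin (m + 2)), σ (Fin.last _) = Fin.last _ →
      ∀ w : Fin (m + 2) → R × ℂ, acP ρ (Fin.init (w ∘ σ)) (f ((w ∘ σ) (Fin.last _))) =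
        sg σ • acP ρ (Fin.init w) (f (w (Fin.last _))) := by
    intro σ hσ w
    refine skew_of_swap (fun w : Fin (m + 2) → R × ℂ => acP ρ (Fin.init w) (f (w (Fin.last _))))
      (fun s => s ≠ Fin.last _) (fun s t hst hs ht w => ?_) σ (fun s h hs => h (hs ▸ hσ)) w
    obtain ⟨i, rfl⟩ := Fin.exists_castSucc_eq.mpr hs
    obtain ⟨j, rfl⟩ := Fin.exists_castSucc_eq.mpr ht
    have hij : i ≠ j := fun h => hst (h ▸ rfl)
    have : Fin.init (w ∘ Equiv.swap i.castSucc j.castSucc) =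
        (Fin.init w : Fin (m + 1) → R × ℂ) ∘ Equiv.swap i j := by
      funext k
      simp only [Fin.init, Function.comp_apply, (Fin.castSucc_injective _).swap_apply]
    rw [this, acP_perm, sg_swap hij, Function.comp_apply,
      Equiv.swap_apply_of_ne_of_ne hs.symm ht.symm, neg_one_smul]
  have hk : ∀ (w : Fin (m + 2) → R × ℂ) (k : Fin (m + 2)), acP ρ (k.removeNth w) (f (w k)) =
      acP ρ (Fin.init (w ∘ toLast k)) (f ((w ∘ toLast k) (Fin.last _))) := by
    intro w k
    rw [comp_toLast, Fin.init_snoc, Fin.snoc_last]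
  rw [dOne_apply, dOne_apply, brP_perm L hf, smul_add, smul_neg, Finset.smul_sum,
    ← Equiv.sum_comp π (fun k => sg π • sg (toLast k) • acP ρ (k.removeNth w) (f (w k)))]
  congr 1
  refine Finset.sum_congr rfl fun k _ => ?_
  -- Moving k last after π differs from moving π k last by σ, which fixes the last place, so `hG`
  -- applies.
  set σ := (toLast (π k))⁻¹ * π * toLast k with hσ
  have h1 : (w ∘ π) ∘ toLast k = (w ∘ toLast (π k)) ∘ σ := by
    funext j
    simp [hσ]
  have h2 : sg (toLast (π k)) * sg σ = sg π * sg (toLast k) := by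
    rw [← sg_mul, ← sg_mul, hσ]
    congr 1
    group
  have h3 : σ (Fin.last _) = Fin.last _ := by
    rw [hσ, Equiv.Perm.mul_apply, Equiv.Perm.mul_apply, toLast_last, Equiv.Perm.inv_eq_iff_eq,
      toLast_last]
  rw [hk, h1, hG σ h3, ← hk, smul_smul, smul_smul]
  congr 1
  linear_combination (sg (toLast (π k)) * sg (toLast k)) * h2 -
    sg σ * sg (toLast k) * sg_mul_self (toLast (π k)) +
    sg π * sg (toLast (π k)) * sg_mul_self (toLast k)

/-- The argument of `dOne` on the left is θ_x f. The bracket term commutes with θ_x by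
`brP_filippov`, the action terms by `acP_comm`. -/
theorem dOne_lieDer {f : R × ℂ → M} (hf : f ∈ Adm R M) (x : Fin (m + 1) → R × ℂ)
    (w : Fin (m + 2) → R × ℂ) :
    dOne ρ (fun u => acP ρ x (f u) - f (brP L (Fin.snoc x u))) w =
      lieDer ρ x (dOne ρ f) w := by
  have hk : ∀ k, acP ρ (k.removeNth w) (acP ρ x (f (w k)) - f (brP L (Fin.snoc x (w k)))) =
      acP ρ x (acP ρ (k.removeNth w) (f (w k))) -
        ∑ s, acP ρ (k.removeNth (Function.update w s (brP L (Fin.snoc x (w s)))))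
          (f (Function.update w s (brP L (Fin.snoc x (w s))) k)) := by
    intro k
    -- The summand s = k changes the argument of f; the others change entries of the acting block.
    rw [Fin.sum_univ_succAbove _ k, Fin.removeNth_update, Function.update_self]
    have : ∀ l, acP ρ (k.removeNth (Function.update w (k.succAbove l)
        (brP L (Fin.snoc x (w (k.succAbove l))))))
          (f (Function.update w (k.succAbove l) (brP L (Fin.snoc x (w (k.succAbove l)))) k)) =
        acP ρ (Function.update (k.removeNth w) l (brP L (Fin.snoc x (k.removeNth w l))))
          (f (w k)) := by
      intro l
      rw [Fin.removeNth_update_succAbove, Function.update_of_ne (Fin.ne_succAbove k l)]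
      rfl
    simp only [this, ← acP_comm, map_sub]
    abel
  rw [lieDer_apply]
  simp only [dOne_apply, hk, brP_filippov L hf x w, map_add, map_neg, map_sum, map_smul, smul_sub,
    Finset.sum_add_distrib, Finset.sum_sub_distrib, Finset.smul_sum, Finset.sum_neg_distrib]
  rw [Finset.sum_comm (f := fun k s => sg (toLast k) • acP ρ (k.removeNth (Function.update w s
    (brP L (Fin.snoc x (w s))))) (f (Function.update w s (brP L (Fin.snoc x (w s))) k)))]
  abel

/-- Up to a global sign this is the first Filippov identity of the action, with v fixed. -/
theorem dOne_act (b : Fin m → R × ℂ) (v : M) :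
    dOne ρ (fun u => acP ρ (Fin.snoc b u) v) = 0 := by
  have hc : ∀ u : R × ℂ, acP ρ (Fin.snoc (α := fun _ => R × ℂ) b u) v =
      sg (toLast (0 : Fin (m + 1))) • acP ρ (Fin.cons (α := fun _ => R × ℂ) u b) v := by
    intro u
    have := comp_toLast (Fin.cons (α := fun _ => R × ℂ) u b) 0
    rw [Fin.removeNth_zero, Fin.tail_cons, Fin.cons_zero] at this
    rw [← this, acP_perm]
  have : (fun u => acP ρ (Fin.snoc (α := fun _ => R × ℂ) b u) v) =
      sg (toLast (0 : Fin (m + 1))) • fun u => acP ρ (Fin.cons (α := fun _ => R × ℂ) u b) v :=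
    funext hc
  rw [this, map_smul]
  funext w
  rw [Pi.smul_apply, dOne_apply, acP_filippov, neg_add_cancel, smul_zero]
  rfl

/-- This is D(θ_x f) = D(ι_x D f). In ι_x D f the bracket term and the action of x make up θ_x f;
every other term has the shape killed by `dOne_act`. -/
theorem dOne_dOne (f : R × ℂ → M) (x : Fin (m + 1) → R × ℂ) :
    dOne ρ (fun u => acP ρ x (f u) - f (brP L (Fin.snoc x u))) =
      dOne ρ (fun u => dOne ρ f (Fin.snoc x u)) := by
  rw [← sub_eq_zero, ← map_sub]
  have : (fun u => acP ρ x (f u) - f (brP L (Fin.snoc x u))) -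
      (fun u => dOne ρ f (Fin.snoc (α := fun _ => R × ℂ) x u)) =
      -∑ k : Fin (m + 1), sg (toLast k.castSucc) •
        fun u => acP ρ (Fin.snoc (k.removeNth x) u) (f (x k)) := by
    funext u
    have h1 : sg (toLast (Fin.last (m + 1))) = 1 := by rw [sg_toLast]; simp
    simp only [Pi.sub_apply, dOne_apply, Fin.sum_univ_castSucc (n := m + 1), Pi.neg_apply,
      Finset.sum_apply, Pi.smul_apply, removeNth_castSucc_snoc, Fin.snoc_castSucc, Fin.snoc_last,
      Fin.removeNth_last, Fin.init_snoc, h1, one_smul]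
    abel
  rw [this, map_neg, map_sum, Finset.sum_eq_zero, neg_zero]
  intro k _
  rw [map_smul, dOne_act, smul_zero]

end

/-! ### Cartan calculus and D² = 0. -/

section

variable {m : ℕ} {R : Type*} [AddCommGroup R] [Module ℂ R] [Module ℂ[X] R] [IsScalarTower ℂ ℂ[X] R]
  {M : Type*} [AddCommGroup M] [Module ℂ M] [Module ℂ[X] M] [IsScalarTower ℂ ℂ[X] M]
  {L : NLieConformalAlgebra m R} (ρ : ConformalRep L M)

/-- The contraction of a function of families with a first block. -/
def contr {p : ℕ} (x : Fin (m + 1) → R × ℂ) :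
    ((Slot m (p + 1) → R × ℂ) → M) →ₗ[ℂ] ((Slot m p → R × ℂ) → M) :=
  LinearMap.funLeft ℂ M (consS x)

theorem contr_apply {p : ℕ} (x : Fin (m + 1) → R × ℂ) (γ : (Slot m (p + 1) → R × ℂ) → M)
    (Y : Slot m p → R × ℂ) : contr x γ Y = γ (consS x Y) := rfl

theorem SlotAdm.contr {p : ℕ} {γ : (Slot m (p + 1) → R × ℂ) → M} (hγ : SlotAdm γ)
    (x : Fin (m + 1) → R × ℂ) : SlotAdm (contr x γ) := by
  intro X s
  simp only [contr_apply, consS_update_tail]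
  exact hγ _ _

/-- The differential of functions of families of pairs, defined by Cartan's formula
`ι_x D γ = θ_x γ - D ι_x γ`. -/
def diff : ∀ p : ℕ, ((Slot m p → R × ℂ) → M) →ₗ[ℂ] ((Slot m (p + 1) → R × ℂ) → M)
  | 0 => (LinearMap.funLeft ℂ M fun X => X ∘ flatEquiv m).comp
      ((dOne ρ).comp (LinearMap.funLeft ℂ M fun z _ => z))
  | p + 1 =>
    { toFun := fun γ X => lieDer ρ (headS X) γ (tailS X) - diff p (contr (headS X) γ) (tailS X)
      map_add' := fun γ δ => by
        funext X
        simp only [map_add, Pi.add_apply]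
        abel
      map_smul' := fun c γ => by
        funext X
        simp only [map_smul, Pi.smul_apply, smul_sub, RingHom.id_apply] }

theorem diff_zero_apply (γ : (Slot m 0 → R × ℂ) → M) (X : Slot m 1 → R × ℂ) :
    diff ρ 0 γ X = dOne ρ (fun z => γ fun _ => z) (X ∘ flatEquiv m) := rfl

theorem diff_succ_apply (p : ℕ) (γ : (Slot m (p + 1) → R × ℂ) → M)
    (X : Slot m (p + 2) → R × ℂ) :
    diff ρ (p + 1) γ X =
      lieDer ρ (headS X) γ (tailS X) - diff ρ p (contr (headS X) γ) (tailS X) := rfl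

theorem contr_diff (p : ℕ) (γ : (Slot m (p + 1) → R × ℂ) → M) (x : Fin (m + 1) → R × ℂ) :
    contr x (diff ρ (p + 1) γ) = lieDer ρ x γ - diff ρ p (contr x γ) := by
  funext Y
  rw [contr_apply, diff_succ_apply, headS_consS, tailS_consS]
  rfl

/-- θ_x also runs over the entries of the first block; once this block is filled with y, these
contribute the correction sum. -/
theorem contr_lieDer (p : ℕ) (γ : (Slot m (p + 1) → R × ℂ) → M) (x y : Fin (m + 1) → R × ℂ) :
    contr y (lieDer ρ x γ) = lieDer ρ x (contr y γ) -
      ∑ l, contr (Function.update y l (brP L (Fin.snoc x (y l)))) γ := by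
  funext Y
  simp only [contr_apply, lieDer_apply, Pi.sub_apply, Finset.sum_apply, sum_slot_succ,
    consS_update_tail, consS_update_head, consS_shift, consS_zero]
  abel

theorem fun_slot_ext {p : ℕ} {γ δ : (Slot m (p + 1) → R × ℂ) → M}
    (h : ∀ x, contr x γ = contr x δ) : γ = δ := by
  funext X
  rw [← consS_headS_tailS X]
  exact congrFun (h (headS X)) (tailS X)

theorem slot_zero_eq {S : Type*} (X : Slot m 0 → S) : X = fun _ => X none := by
  funext s
  rcases s with _ | ⟨i, _⟩
  · rfl
  · exact i.elim0

theorem SlotAdm.const {γ : (Slot m 0 → R × ℂ) → M} (hγ : SlotAdm γ) :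
    (fun z => γ fun _ => z) ∈ Adm R M := by
  have := hγ 0 none
  have e : ∀ u : R × ℂ, Function.update (0 : Slot m 0 → R × ℂ) none u = fun _ => u := by
    intro u
    rw [slot_zero_eq (Function.update _ _ _), Function.update_self]
  simpa only [e] using this

theorem lieDer_const (γ : (Slot m 0 → R × ℂ) → M) (x : Fin (m + 1) → R × ℂ) (z : R × ℂ) :
    lieDer ρ x γ (fun _ => z) =
      acP ρ x (γ fun _ => z) - γ fun _ => brP L (Fin.snoc x z) := by
  rw [lieDer_apply]
  congr 1
  rw [Fintype.sum_option, Finset.univ_eq_empty, Finset.sum_empty, add_zero,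
    slot_zero_eq (Function.update _ _ _), Function.update_self]

/-- The differential commutes with Lie derivatives. -/
theorem diff_lieDer (p : ℕ) {γ : (Slot m p → R × ℂ) → M} (hγ : SlotAdm γ)
    (x : Fin (m + 1) → R × ℂ) : diff ρ p (lieDer ρ x γ) = lieDer ρ x (diff ρ p γ) := by
  induction p generalizing x with
  | zero =>
    funext X
    rw [diff_zero_apply]
    simp only [lieDer_const]
    rw [dOne_lieDer ρ hγ.const, lieDer_apply, lieDer_apply, diff_zero_apply,
      ← Equiv.sum_comp (flatEquiv m)]
    congr 1
    refine Finset.sum_congr rfl fun s _ => ?_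
    rw [diff_zero_apply, Function.update_comp_equiv, Equiv.symm_apply_apply]
    rfl
  | succ p ih =>
    refine fun_slot_ext fun y => ?_
    have h : lieDer ρ x (lieDer ρ y γ) - lieDer ρ y (lieDer ρ x γ) =
        ∑ l, lieDer ρ (Function.update y l (brP L (Fin.snoc x (y l)))) γ := by
      funext X
      rw [Finset.sum_apply]
      exact lieDer_comm ρ hγ x y X
    -- After contraction with y, the induction hypothesis for ι_y γ removes D θ_x ι_y γ, the sums of
    -- D ι agree, and the remaining Lie derivatives match by `lieDer_comm`.
    rw [contr_diff, contr_lieDer, contr_lieDer, map_sub, map_sum, ih (hγ.contr y), contr_diff,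
      map_sub]
    simp only [contr_diff, Finset.sum_sub_distrib, ← h]
    abel

/-- The square of the differential vanishes. -/
theorem diff_diff (p : ℕ) {γ : (Slot m p → R × ℂ) → M} (hγ : SlotAdm γ) :
    diff ρ (p + 1) (diff ρ p γ) = 0 := by
  induction p with
  | zero =>
    refine fun_slot_ext fun x => ?_
    rw [contr_diff, ← diff_lieDer ρ 0 hγ]
    funext Y
    have h1 : ∀ z : R × ℂ, contr x (diff ρ 0 γ) (fun _ : Slot m 0 => z) =
        dOne ρ (fun z => γ fun _ => z) (Fin.snoc x z) := by
      intro z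
      rw [contr_apply, diff_zero_apply, comp_flatEquiv]
      rfl
    rw [Pi.sub_apply, diff_zero_apply, diff_zero_apply]
    simp only [h1, lieDer_const]
    rw [dOne_dOne, sub_self]
    rfl
  | succ p ih =>
    refine fun_slot_ext fun x => ?_
    -- ι_x D² γ = θ_x Dγ - D θ_x γ + D² ι_x γ, where the last term vanishes by induction.
    rw [contr_diff, contr_diff, map_sub, ih (hγ.contr x), diff_lieDer ρ _ hγ, sub_zero, sub_self,
      map_zero]

end

/-! ### The differential preserves admissibility and skew-symmetry in the blocks. -/

section

variable {m : ℕ} {R : Type*} [AddCommGroup R] [Module ℂ R] [Module ℂ[X] R] [IsScalarTower ℂ ℂ[X] R]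
  {M : Type*} [AddCommGroup M] [Module ℂ M] [Module ℂ[X] M] [IsScalarTower ℂ ℂ[X] M]
  {L : NLieConformalAlgebra m R} (ρ : ConformalRep L M)

theorem Adm.sub {f g : R × ℂ → M} (hf : f ∈ Adm R M) (hg : g ∈ Adm R M) :
    (fun u => f u - g u) ∈ Adm R M := Submodule.sub_mem _ hf hg

theorem Adm.sum {ι : Type*} (s : Finset ι) {f : ι → R × ℂ → M} (hf : ∀ i ∈ s, f i ∈ Adm R M) :
    (fun u => ∑ i ∈ s, f i u) ∈ Adm R M := by
  have := Submodule.sum_mem _ hf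
  rwa [show ∑ i ∈ s, f i = fun u => ∑ i ∈ s, f i u from funext fun u => Finset.sum_apply _ _ _]
    at this

theorem lieDer_adm {σ : Type*} [Fintype σ] [DecidableEq σ] {F : R × ℂ → (σ → R × ℂ) → M}
    (hF : ∀ Y, (fun u => F u Y) ∈ Adm R M) (x : Fin (m + 1) → R × ℂ) (Y : σ → R × ℂ) :
    (fun u => lieDer ρ x (F u) Y) ∈ Adm R M :=
  Adm.sub (Adm.comp (hF Y) (acP ρ x)) (Adm.sum _ fun _ _ => hF _)

/-- Needed for entries of the first block: in the recursion such an entry is a parameter of the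
contracted function, not one of its arguments. -/
theorem diff_adm (p : ℕ) {F : R × ℂ → (Slot m p → R × ℂ) → M}
    (hF : ∀ Y, (fun u => F u Y) ∈ Adm R M) (Y : Slot m (p + 1) → R × ℂ) :
    (fun u => diff ρ p (F u) Y) ∈ Adm R M := by
  induction p with
  | zero =>
    exact Submodule.add_mem _ (Submodule.neg_mem _ (hF _)) (Adm.sum _ fun k _ =>
      Submodule.smul_mem _ _ (Adm.comp (hF _) (acP ρ _)))
  | succ p ih =>
    exact Adm.sub (lieDer_adm ρ hF _ _)
      (ih (F := fun u => contr (headS Y) (F u)) (fun _ => hF _) _)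

theorem SlotAdm.lieDer {σ : Type*} [Fintype σ] [DecidableEq σ] {γ : (σ → R × ℂ) → M}
    (hγ : SlotAdm γ) (x : Fin (m + 1) → R × ℂ) : SlotAdm (lieDer ρ x γ) := by
  intro Y s
  refine Adm.sub (Adm.comp (hγ Y s) (acP ρ x)) (Adm.sum _ fun t _ => ?_)
  by_cases h : t = s
  · subst h
    simp only [Function.update_self, Function.update_idem]
    exact Adm.brP_snoc L (hγ Y t) x
  · simp only [Function.update_of_ne h, Function.update_comm (Ne.symm h)]
    exact hγ _ s

theorem dOne_update_adm {f : R × ℂ → M} (hf : f ∈ Adm R M) (w : Fin (m + 2) → R × ℂ)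
    (s : Fin (m + 2)) : (fun u => dOne ρ f (Function.update w s u)) ∈ Adm R M := by
  refine Submodule.add_mem _ (Submodule.neg_mem _ (Adm.brP_update L hf w s))
    (Adm.sum _ fun k _ => Submodule.smul_mem _ _ ?_)
  by_cases h : s = k
  · subst h
    simp only [Fin.removeNth_update, Function.update_self]
    exact Adm.comp hf (acP ρ _)
  · obtain ⟨l, rfl⟩ := Fin.exists_succAbove_eq h
    simp only [Fin.removeNth_update_succAbove, Function.update_of_ne (Ne.symm h)]
    exact Adm.acP_update ρ _ _ _

theorem SlotAdm.diff (p : ℕ) {γ : (Slot m p → R × ℂ) → M} (hγ : SlotAdm γ) :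
    SlotAdm (diff ρ p γ) := by
  induction p with
  | zero =>
    intro X s
    simp only [diff_zero_apply, Function.update_comp_equiv]
    exact dOne_update_adm ρ hγ.const _ _
  | succ p ih =>
    intro X s
    rw [← consS_headS_tailS X]
    induction s using Slot.cases_shift with
    | h0 j =>
      simp only [← consS_update_head, diff_succ_apply, headS_consS, tailS_consS]
      refine Adm.sub (Adm.sub (Adm.acP_update ρ _ _ _) (Adm.sum _ fun s _ => ?_))
        (diff_adm ρ p (F := fun u => NLieConformal.contr (Function.update (headS X) j u) γ) (fun Y => ?_) _)
      · simp only [Fin.snoc_update]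
        exact Adm.brP_update L (hγ _ s) _ _
      · simp only [contr_apply, consS_update_head]
        exact hγ _ _
    | hs s =>
      simp only [← consS_update_tail, diff_succ_apply, headS_consS, tailS_consS]
      exact Adm.sub (hγ.lieDer ρ _ _ s) (ih (hγ.contr _) _ s)

/-- Skew-symmetry under transpositions of two entries of the same block. -/
def BlockSkew {p : ℕ} (γ : (Slot m p → R × ℂ) → M) : Prop :=
  ∀ s t : Slot m p, s ≠ t → s.block = t.block → ∀ X, γ (X ∘ Equiv.swap s t) = -γ X

theorem Slot.block_shift {p : ℕ} {s t : Slot m p} (hst : s ≠ t) (h : s.block = t.block) :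
    s.shift.block = t.shift.block := by
  rcases s with _ | ⟨i, j⟩ <;> rcases t with _ | ⟨i', j'⟩ <;>
    simp_all [Slot.block, Slot.shift]
  all_goals omega

theorem Slot.block_shift_inj {p : ℕ} {s t : Slot m (p + 1)} (h : s.shift.block = t.shift.block) :
    s.block = t.block := by
  rcases s with _ | ⟨i, j⟩ <;> rcases t with _ | ⟨i', j'⟩ <;>
    simp_all [Slot.block, Slot.shift]

/-- While another block remains, the last argument lies outside the first block. With a single block
it lies inside, which is why skew-symmetry in degree 1 is proved separately for all n entries. -/
theorem Slot.block_shift_ne {p : ℕ} (s : Slot m (p + 1)) (j : Fin (m + 1)) :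
    s.shift.block ≠ Slot.block (some (0, j) : Slot m (p + 2)) := by
  rcases s with _ | ⟨i, j⟩ <;> simp [Slot.block, Slot.shift]

theorem consS_comp_swap_tail {p : ℕ} {S : Type*} (x : Fin (m + 1) → S) (Y : Slot m p → S)
    (s t : Slot m p) :
    consS x (Y ∘ Equiv.swap s t) = consS x Y ∘ Equiv.swap s.shift t.shift := by
  funext r
  induction r using Slot.cases_shift with
  | h0 j =>
    rw [Function.comp_apply, Equiv.swap_apply_of_ne_of_ne (Slot.shift_ne_zero s j).symm
      (Slot.shift_ne_zero t j).symm]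
    rfl
  | hs r => rw [Function.comp_apply, Slot.shift_injective.swap_apply, consS_shift, consS_shift]; rfl

theorem consS_comp_swap_head {p : ℕ} {S : Type*} (x : Fin (m + 1) → S) (Y : Slot m p → S)
    (i j : Fin (m + 1)) :
    consS (x ∘ Equiv.swap i j) Y = consS x Y ∘ Equiv.swap (some (0, i)) (some (0, j)) := by
  funext r
  induction r using Slot.cases_shift with
  | h0 k =>
    have hinj : Function.Injective fun k : Fin (m + 1) => (some (0, k) : Slot m (p + 1)) := by
      intro a b h; simpa using h
    rw [Function.comp_apply, hinj.swap_apply]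
    rfl
  | hs r =>
    rw [Function.comp_apply, Equiv.swap_apply_of_ne_of_ne (Slot.shift_ne_zero r _)
      (Slot.shift_ne_zero r _), consS_shift, consS_shift]

theorem BlockSkew.contr {p : ℕ} {γ : (Slot m (p + 1) → R × ℂ) → M} (hγ : BlockSkew γ)
    (x : Fin (m + 1) → R × ℂ) : BlockSkew (contr x γ) := by
  intro s t hst h Y
  rw [contr_apply, consS_comp_swap_tail, hγ _ _ (Slot.shift_injective.ne hst)
    (Slot.block_shift hst h)]
  rfl

theorem lieDer_comp {σ : Type*} [Fintype σ] [DecidableEq σ] {γ : (σ → R × ℂ) → M}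
    (π : Equiv.Perm σ) (c : ℂ) (hγ : ∀ X, γ (X ∘ π) = c • γ X) (x : Fin (m + 1) → R × ℂ)
    (X : σ → R × ℂ) : lieDer ρ x γ (X ∘ π) = c • lieDer ρ x γ X := by
  rw [lieDer_apply, lieDer_apply, hγ, smul_sub, map_smul, Finset.smul_sum]
  congr 1
  refine Fintype.sum_equiv π _ _ fun s => ?_
  rw [← hγ, Function.update_comp_equiv, Equiv.symm_apply_apply]
  rfl

theorem lieDer_swap {σ : Type*} [Fintype σ] [DecidableEq σ] {γ : (σ → R × ℂ) → M}
    (hγ : SlotAdm γ) {i j : Fin (m + 1)} (hij : i ≠ j) (x : Fin (m + 1) → R × ℂ)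
    (X : σ → R × ℂ) : lieDer ρ (x ∘ Equiv.swap i j) γ X = -lieDer ρ x γ X := by
  have hs : ∀ u : R × ℂ, Fin.snoc (α := fun _ => R × ℂ) (x ∘ Equiv.swap i j) u =
      Fin.snoc (α := fun _ => R × ℂ) x u ∘ Equiv.swap i.castSucc j.castSucc := by
    intro u
    funext k
    induction k using Fin.lastCases with
    | last =>
      rw [Function.comp_apply, Equiv.swap_apply_of_ne_of_ne (Fin.castSucc_lt_last i).ne'
        (Fin.castSucc_lt_last j).ne', Fin.snoc_last, Fin.snoc_last]
    | cast k =>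
      rw [Function.comp_apply, (Fin.castSucc_injective _).swap_apply, Fin.snoc_castSucc,
        Fin.snoc_castSucc]
      rfl
  rw [lieDer_apply, lieDer_apply, acP_perm, sg_swap hij, neg_one_smul, neg_sub', sub_right_inj,
    ← Finset.sum_neg_distrib]
  refine Finset.sum_congr rfl fun s _ => ?_
  have := brP_perm L (hγ X s) (Equiv.swap i.castSucc j.castSucc)
    (Fin.snoc (α := fun _ => R × ℂ) x (X s))
  rw [sg_swap ((Fin.castSucc_injective _).ne hij), neg_one_smul] at this
  rw [hs, this]

/-- Two entries of the first block are interchanged by skew-symmetry of θ_x and ι_x in x; two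
entries of a later block by equivariance of θ_x and induction. -/
theorem BlockSkew.diff (p : ℕ) {γ : (Slot m p → R × ℂ) → M} (hγ : SlotAdm γ)
    (hs : BlockSkew γ) : BlockSkew (diff ρ p γ) := by
  induction p with
  | zero =>
    intro s t hst _ X
    obtain ⟨s, rfl⟩ := (flatEquiv m).surjective s
    obtain ⟨t, rfl⟩ := (flatEquiv m).surjective t
    have : (X ∘ Equiv.swap (flatEquiv m s) (flatEquiv m t)) ∘ flatEquiv m =
        (X ∘ flatEquiv m) ∘ Equiv.swap s t := by
      funext k
      simp only [Function.comp_apply, (flatEquiv m).injective.swap_apply]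
    rw [diff_zero_apply, this, dOne_perm ρ hγ.const, sg_swap (fun h => hst (congrArg _ h)),
      neg_one_smul]
    rfl
  | succ p ih =>
    intro s t hst hb X
    rw [← consS_headS_tailS X]
    induction s using Slot.cases_shift with
    | h0 i =>
      induction t using Slot.cases_shift with
      | h0 j =>
        have hij : i ≠ j := fun h => hst (h ▸ rfl)
        have hc : NLieConformal.contr (headS X ∘ Equiv.swap i j) γ =
            -NLieConformal.contr (headS X) γ := by
          funext Y
          rw [contr_apply, consS_comp_swap_head, hs (some (0, i)) (some (0, j)) (fun h => hij (by simpa using h)) rfl]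
          rfl
        rw [← consS_comp_swap_head, diff_succ_apply, diff_succ_apply]
        simp only [headS_consS, tailS_consS]
        rw [lieDer_swap ρ hγ hij, hc, map_neg, Pi.neg_apply]
        abel
      | hs t => exact absurd hb.symm (Slot.block_shift_ne t i)
    | hs s =>
      induction t using Slot.cases_shift with
      | h0 j => exact absurd hb (Slot.block_shift_ne s j)
      | hs t =>
        have hst' : s ≠ t := fun h => hst (h ▸ rfl)
        have hb' := Slot.block_shift_inj hb
        rw [← consS_comp_swap_tail, diff_succ_apply, diff_succ_apply]
        simp only [headS_consS, tailS_consS]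
        rw [lieDer_comp ρ (Equiv.swap s t) (-1) (fun X => by rw [hs s t hst' hb', neg_one_smul]),
          ih (hγ.contr _) (hs.contr _) s t hst' hb', neg_one_smul]
        abel

end

/-! ### The recursion unfolds to the four sums. -/

section

variable {m : ℕ} {R : Type*} [AddCommGroup R] [Module ℂ R] [Module ℂ[X] R] [IsScalarTower ℂ ℂ[X] R]
  {M : Type*} [AddCommGroup M] [Module ℂ M] [Module ℂ[X] M] [IsScalarTower ℂ ℂ[X] M]
  {L : NLieConformalAlgebra m R} (ρ : ConformalRep L M)

/-- The four-summand expression for the differential of a function of families of pairs. -/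
def fourSum {p : ℕ} (g : (Slot m p → R × ℂ) → M) (A : Fin (p + 1) → Fin (m + 1) → R × ℂ)
    (z : R × ℂ) : M :=
  (∑ i : Fin (p + 1), ∑ j ∈ Finset.univ.filter (fun j : Fin (p + 1) => i < j),
    ∑ l : Fin (m + 1), (-1 : ℂ) ^ ((i : ℕ) + 1) •
      g (slots (i.removeNth (Function.update A j
        (Function.update (A j) l (brP L (Fin.snoc (A i) (A j l)))))) z))
  + (∑ i : Fin (p + 1), (-1 : ℂ) ^ ((i : ℕ) + 1) •
      g (slots (i.removeNth A) (brP L (Fin.snoc (A i) z))))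
  + (∑ i : Fin (p + 1), (-1 : ℂ) ^ (i : ℕ) • acP ρ (A i) (g (slots (i.removeNth A) z)))
  + (∑ k : Fin (m + 1), (-1 : ℂ) ^ (m + p + 3 - (k : ℕ)) •
      acP ρ (Fin.snoc (k.removeNth (A (Fin.last p))) z)
        (g (slots (Fin.init A) (A (Fin.last p) k))))

theorem removeNth_succ_eq_cons {n : ℕ} {S : Type*} (A : Fin (n + 2) → S) (i : Fin (n + 1)) :
    i.succ.removeNth A = Fin.cons (α := fun _ => S) (A 0) (i.removeNth (Fin.tail A)) := by
  funext k
  induction k using Fin.cases with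
  | zero => simp [Fin.removeNth_apply]
  | succ k => simp [Fin.removeNth_apply, Fin.tail]

theorem slots_fin_cons {p : ℕ} {S : Type*} (x : Fin (m + 1) → S) (A : Fin p → Fin (m + 1) → S)
    (z : S) : slots (Fin.cons x A : Fin (p + 1) → Fin (m + 1) → S) z = consS x (slots A z) := by
  rw [slots_cons, Fin.tail_cons, Fin.cons_zero]

theorem update_slots_some {p : ℕ} {S : Type*} (A : Fin p → Fin (m + 1) → S) (z u : S)
    (j : Fin p) (l : Fin (m + 1)) :
    Function.update (slots A z) (some (j, l)) u =
      slots (Function.update A j (Function.update (A j) l u)) z := by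
  funext s
  rcases s with _ | ⟨i, k⟩
  · rfl
  · by_cases hi : i = j
    · subst hi
      by_cases hk : k = l
      · subst hk; simp [slots]
      · simp [slots, hk]
    · simp [slots, hi]

theorem update_slots_none {p : ℕ} {S : Type*} (A : Fin p → Fin (m + 1) → S) (z u : S) :
    Function.update (slots A z) none u = slots A u := by
  funext s
  rcases s with _ | ⟨i, k⟩ <;> simp [slots]

theorem lieDer_slots {p : ℕ} (x : Fin (m + 1) → R × ℂ) (g : (Slot m p → R × ℂ) → M)
    (A : Fin p → Fin (m + 1) → R × ℂ) (z : R × ℂ) :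
    lieDer ρ x g (slots A z) = acP ρ x (g (slots A z)) - (g (slots A (brP L (Fin.snoc x z))) +
      ∑ j, ∑ l, g (slots (Function.update A j (Function.update (A j) l
        (brP L (Fin.snoc x (A j l))))) z)) := by
  rw [lieDer_apply, Fintype.sum_option, update_slots_none, Fintype.sum_prod_type]
  simp only [update_slots_some]
  rfl

/-- In the first three sums, the terms with i = 0 form the Lie derivative along the first block. All
other terms leave that block in place, and counting from the next block flips their signs, including
those of the fourth sum. -/
theorem fourSum_succ {p : ℕ} (g : (Slot m (p + 1) → R × ℂ) → M)
    (A : Fin (p + 2) → Fin (m + 1) → R × ℂ) (z : R × ℂ) :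
    fourSum ρ g A z = lieDer ρ (A 0) g (slots (Fin.tail A) z) -
      fourSum ρ (contr (A 0) g) (Fin.tail A) z := by
  have hu : ∀ (j : Fin (p + 1)) (v : Fin (m + 1) → R × ℂ),
      Fin.tail (Function.update A j.succ v) = Function.update (Fin.tail A) j v :=
    fun j v => Fin.tail_update_succ _ _ _
  have hsign : ∀ k : Fin (m + 1), (-1 : ℂ) ^ (m + (p + 1) + 3 - (k : ℕ)) =
      -(-1) ^ (m + p + 3 - (k : ℕ)) := by
    intro k
    rw [show m + (p + 1) + 3 - (k : ℕ) = (m + p + 3 - k) + 1 by omega, pow_succ]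
    ring
  have hinit : (Fin.init A : Fin (p + 1) → _) =
      Fin.cons (α := fun _ => Fin (m + 1) → R × ℂ) (A 0) (Fin.init (Fin.tail A)) := by
    rw [Fin.init_def]
    funext k
    induction k using Fin.cases <;> rfl
  have hzero : ∀ (j : Fin (p + 1)) (v : Fin (m + 1) → R × ℂ),
      Function.update A j.succ v 0 = A 0 :=
    fun j v => Function.update_of_ne (Fin.succ_ne_zero j).symm _ _
  have htail : ∀ i, Fin.tail A i = A i.succ := fun _ => rfl
  have hite : ∀ (c : Prop) [Decidable c] (v : M),
      (if c then -v else 0) = -(if c then v else 0) := by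
    intro c _ v
    split_ifs <;> simp
  rw [fourSum, fourSum, lieDer_slots]
  simp only [Fin.sum_univ_succ (n := p + 1), Finset.sum_filter, hu, hsign, hinit,
    Fin.removeNth_zero, removeNth_succ_eq_cons, slots_fin_cons, contr_apply, Fin.not_lt_zero,
    Fin.succ_pos, Fin.succ_lt_succ_iff, if_true, if_false, Fin.val_zero, Fin.val_succ, zero_add,
    pow_succ (-1 : ℂ), pow_zero, mul_neg, mul_one, one_smul, neg_smul,
    Finset.sum_neg_distrib, neg_neg, hzero, htail, hite, Fin.succ_last]
  abel

theorem diff_slots (p : ℕ) (g : (Slot m p → R × ℂ) → M) (A : Fin (p + 1) → Fin (m + 1) → R × ℂ)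
    (z : R × ℂ) : diff ρ p g (slots A z) = fourSum ρ g A z := by
  induction p with
  | zero =>
    have h0 : ∀ z : R × ℂ, ∀ B : Fin 0 → Fin (m + 1) → R × ℂ, (slots B z : Slot m 0 → R × ℂ) =
      fun _ => z := fun z B => slot_zero_eq (slots B z)
    have hsign : ∀ k : Fin (m + 1), (-1 : ℂ) ^ (m + 0 + 3 - (k : ℕ)) =
        (-1) ^ (m + 1 - (k : ℕ)) := by
      intro k
      rw [show m + 0 + 3 - (k : ℕ) = (m + 1 - k) + 2 by omega, pow_add]
      norm_num
    have hsum : ∀ F : Fin (0 + 1) → M, ∑ i, F i = F 0 := fun F => Fin.sum_univ_one F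
    have hf : headS (slots A z) = A 0 := rfl
    have hn : slots A z none = z := rfl
    -- With one block, the last summand of `dOne` is the third sum and its other summands are the
    -- fourth; the first sum is empty.
    rw [diff_zero_apply, comp_flatEquiv, hf, hn, dOne_apply, fourSum, Fin.sum_univ_castSucc (n := m + 1)]
    simp only [Finset.sum_filter, hsum,
      lt_self_iff_false, if_false, h0, hsign, sg_toLast, removeNth_castSucc_snoc, Fin.removeNth_last,
      Fin.init_snoc, Fin.snoc_castSucc, Fin.snoc_last, Fin.val_castSucc, Fin.val_last,
      Fin.val_zero, zero_add, pow_one, pow_zero, one_smul, neg_smul, Nat.sub_self, Fin.last_zero]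
    abel
  | succ p ih =>
    rw [diff_succ_apply, fourSum_succ, ← ih, slots_cons, headS_consS, tailS_consS]

end

/-! ### Polynomial dependence on the indeterminates. -/

section

section IsPoly

variable {τ : Type*} {N : Type*} [AddCommGroup N] [Module ℂ N] {R : Type*} [AddCommGroup R]
  [Module ℂ R]

/-- The function `f` of complex points is given by a polynomial with coefficients in `N`. -/
def IsPoly (f : (τ → ℂ) → N) : Prop := ∃ P : LPoly τ N, ∀ lam, ev lam P = f lam

theorem IsPoly.add {f g : (τ → ℂ) → N} (hf : IsPoly f) (hg : IsPoly g) :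
    IsPoly fun lam => f lam + g lam := by
  obtain ⟨P, hP⟩ := hf
  obtain ⟨Q, hQ⟩ := hg
  exact ⟨P + Q, fun lam => by rw [map_add, hP, hQ]⟩

theorem IsPoly.const_smul {f : (τ → ℂ) → N} (hf : IsPoly f) (c : ℂ) :
    IsPoly fun lam => c • f lam := by
  obtain ⟨P, hP⟩ := hf
  exact ⟨c • P, fun lam => by rw [map_smul, hP]⟩

theorem IsPoly.neg {f : (τ → ℂ) → N} (hf : IsPoly f) : IsPoly fun lam => -f lam := by
  simpa using hf.const_smul (-1)

theorem IsPoly.sub {f g : (τ → ℂ) → N} (hf : IsPoly f) (hg : IsPoly g) :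
    IsPoly fun lam => f lam - g lam := by
  simpa [sub_eq_add_neg] using hf.add hg.neg

theorem isPoly_const (v : N) : IsPoly fun _ : τ → ℂ => v :=
  ⟨1 ⊗ₜ v, fun lam => by simp⟩

theorem IsPoly.sum {ι : Type*} (s : Finset ι) {f : ι → (τ → ℂ) → N} (hf : ∀ i ∈ s, IsPoly (f i)) :
    IsPoly fun lam => ∑ i ∈ s, f i lam := by
  choose! P hP using hf
  exact ⟨∑ i ∈ s, P i, fun lam => by
    rw [map_sum]; exact Finset.sum_congr rfl fun i hi => hP i hi lam⟩

theorem IsPoly.eval_smul {f : (τ → ℂ) → N} (hf : IsPoly f) (Q : MvPolynomial τ ℂ) :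
    IsPoly fun lam => MvPolynomial.eval lam Q • f lam := by
  obtain ⟨P, hP⟩ := hf
  obtain rfl : (fun lam => ev lam P) = f := funext hP
  clear hP
  induction P using TensorProduct.induction_on with
  | zero => exact ⟨0, fun lam => by simp⟩
  | tmul P v => exact ⟨(Q * P) ⊗ₜ v, fun lam => by simp [mul_smul]⟩
  | add x y hx hy => simpa only [map_add, smul_add] using hx.add hy

/-- The complex-valued function `f` of complex points is given by a polynomial. -/
def IsPolyC (f : (τ → ℂ) → ℂ) : Prop := ∃ Q : MvPolynomial τ ℂ, ∀ lam, MvPolynomial.eval lam Q = f lam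

theorem isPoly_ev {σ : Type*} {mu : (τ → ℂ) → σ → ℂ} (hmu : ∀ s, IsPolyC fun lam => mu lam s)
    (P : LPoly σ N) : IsPoly fun lam => ev (mu lam) P := by
  choose Q hQ using hmu
  induction P using TensorProduct.induction_on with
  | zero => exact ⟨0, fun lam => by simp⟩
  | tmul P v =>
    refine ⟨MvPolynomial.bind₁ Q P ⊗ₜ v, fun lam => ?_⟩
    simp only [ev_tmul]
    congr 1
    induction P using MvPolynomial.induction_on with
    | C c => simp
    | add p q hp hq => simp [hp, hq]
    | mul_X p i hp => simp [hp, hQ]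
  | add x y hx hy => simpa only [map_add] using hx.add hy

variable {σ σ' : Type*} [Fintype σ]

/-- Entries may themselves be polynomials with coefficients in `R`, as brackets are. Multilinearity
pulls their scalar parts out one entry at a time; for constant entries only the substitution
`isPoly_ev` is left. -/
theorem isPoly_multilinear {mu : (τ → ℂ) → σ' → ℂ} (hmu : ∀ s, IsPolyC fun lam => mu lam s)
    (γ : MultilinearMap ℂ (fun _ : σ => R) (LPoly σ' N)) {a : (τ → ℂ) → σ → R}
    (ha : ∀ s, IsPoly fun lam => a lam s) : IsPoly fun lam => ev (mu lam) (γ (a lam)) := by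
  classical
  -- T is the set of entries still allowed to vary with the point.
  suffices h : ∀ T : Finset σ, ∀ a : (τ → ℂ) → σ → R, (∀ s, IsPoly fun lam => a lam s) →
      (∀ s ∉ T, ∃ r, ∀ lam, a lam s = r) → IsPoly fun lam => ev (mu lam) (γ (a lam)) from
    h Finset.univ a ha fun s hs => absurd (Finset.mem_univ s) hs
  intro T
  induction T using Finset.induction_on with
  | empty =>
    intro a _ hc
    choose r hr using fun s => hc s (Finset.notMem_empty s)
    have : a = fun _ => r := funext fun lam => funext fun s => hr s lam
    rw [this]
    exact isPoly_ev hmu _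
  | insert s T hs ih =>
    intro a ha hc
    obtain ⟨P, hP⟩ := ha s
    have key : ∀ P : LPoly τ R,
        IsPoly fun lam => ev (mu lam) (γ (Function.update (a lam) s (ev lam P))) := by
      intro P
      induction P using TensorProduct.induction_on with
      | zero => simpa using isPoly_const (0 : N)
      | tmul Q r =>
        simp only [ev_tmul, MultilinearMap.map_update_smul, map_smul]
        refine IsPoly.eval_smul (ih (fun lam => Function.update (a lam) s r) (fun t => ?_)
          (fun t ht => ?_)) Q
        · by_cases h : t = s
          · subst h; simpa using isPoly_const r
          · simpa [h] using ha t
        · by_cases h : t = s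
          · subst h; exact ⟨r, fun lam => by simp⟩
          · simpa [h] using hc t (by simp [h, ht])
      | add x y hx hy => simpa only [map_add, MultilinearMap.map_update_add] using hx.add hy
    simpa only [hP, Function.update_eq_self] using key P

theorem isPoly_multilinear_linear {V : Type*} [AddCommGroup V] [Module ℂ V]
    {mu : (τ → ℂ) → σ' → ℂ} (hmu : ∀ s, IsPolyC fun lam => mu lam s)
    (B : MultilinearMap ℂ (fun _ : σ => R) (V →ₗ[ℂ] LPoly σ' N)) {a : (τ → ℂ) → σ → R}
    (ha : ∀ s, IsPoly fun lam => a lam s) {v : (τ → ℂ) → V} (hv : IsPoly v) :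
    IsPoly fun lam => ev (mu lam) (B (a lam) (v lam)) := by
  obtain ⟨P, hP⟩ := hv
  obtain rfl : (fun lam => ev lam P) = v := funext hP
  clear hP
  induction P using TensorProduct.induction_on with
  | zero => simpa using isPoly_const (0 : N)
  | tmul Q w =>
    simp only [ev_tmul, map_smul]
    exact IsPoly.eval_smul (isPoly_multilinear hmu
      ((LinearMap.applyₗ (R := ℂ) w).compMultilinearMap B) ha) Q
  | add x y hx hy => simpa only [map_add] using hx.add hy

end IsPoly

variable {m : ℕ} {R : Type*} [AddCommGroup R] [Module ℂ R] [Module ℂ[X] R] [IsScalarTower ℂ ℂ[X] R]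
  {M : Type*} [AddCommGroup M] [Module ℂ M] [Module ℂ[X] M] [IsScalarTower ℂ ℂ[X] M]
  {L : NLieConformalAlgebra m R} (ρ : ConformalRep L M) {τ : Type*}

/-- A pair that depends polynomially on a complex point. -/
def PolyPair (u : (τ → ℂ) → R × ℂ) : Prop :=
  IsPoly (fun lam => (u lam).1) ∧ IsPolyC fun lam => (u lam).2

theorem PolyPair.snoc {n : ℕ} {x : (τ → ℂ) → Fin n → R × ℂ} {u : (τ → ℂ) → R × ℂ}
    (hx : ∀ k, PolyPair fun lam => x lam k) (hu : PolyPair u) (k : Fin (n + 1)) :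
    PolyPair fun lam => Fin.snoc (α := fun _ => R × ℂ) (x lam) (u lam) k := by
  induction k using Fin.lastCases with
  | last => simpa only [Fin.snoc_last] using hu
  | cast k => simpa only [Fin.snoc_castSucc] using hx k

theorem PolyPair.update {σ : Type*} [DecidableEq σ] {X : (τ → ℂ) → σ → R × ℂ}
    {u : (τ → ℂ) → R × ℂ} (hX : ∀ k, PolyPair fun lam => X lam k) (hu : PolyPair u) (s t : σ) :
    PolyPair fun lam => Function.update (X lam) s (u lam) t := by
  by_cases h : t = s
  · subst h; simpa only [Function.update_self] using hu
  · simpa only [Function.update_of_ne h] using hX t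

theorem PolyPair.brP {w : (τ → ℂ) → Fin (m + 2) → R × ℂ} (hw : ∀ k, PolyPair fun lam => w lam k) :
    PolyPair fun lam => brP L (w lam) := by
  refine ⟨isPoly_multilinear_linear (fun s => (hw _).2) L.bracket (fun s => (hw _).1) (hw _).1, ?_⟩
  choose Q hQ using fun k => (hw k).2
  exact ⟨∑ k, Q k, fun lam => by rw [map_sum]; exact Finset.sum_congr rfl fun k _ => hQ k lam⟩

theorem IsPoly.acP {x : (τ → ℂ) → Fin (m + 1) → R × ℂ} (hx : ∀ k, PolyPair fun lam => x lam k)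
    {v : (τ → ℂ) → M} (hv : IsPoly v) : IsPoly fun lam => acP ρ (x lam) (v lam) :=
  isPoly_multilinear_linear (fun s => (hx s).2) ρ.act (fun s => (hx s).1) hv

/-- A function of families of pairs, depending on a complex point, that has polynomial values on
all families depending polynomially on the point. -/
def PolyFamily {σ : Type*} (F : (τ → ℂ) → (σ → R × ℂ) → M) : Prop :=
  ∀ X : (τ → ℂ) → σ → R × ℂ, (∀ s, PolyPair fun lam => X lam s) → IsPoly fun lam => F lam (X lam)

theorem PolyFamily.lieDer {σ : Type*} [Fintype σ] [DecidableEq σ]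
    {F : (τ → ℂ) → (σ → R × ℂ) → M} (hF : PolyFamily F) {x : (τ → ℂ) → Fin (m + 1) → R × ℂ}
    (hx : ∀ k, PolyPair fun lam => x lam k) : PolyFamily fun lam => lieDer ρ (x lam) (F lam) := by
  intro X hX
  exact (IsPoly.acP ρ hx (hF X hX)).sub (IsPoly.sum _ fun s _ =>
    hF _ fun t => PolyPair.update hX (PolyPair.brP (PolyPair.snoc hx (hX s))) s t)

/-- The recursion contracts with a first block that depends on the point, so the function itself
must be allowed to vary with the point. -/
theorem PolyFamily.diff (p : ℕ) {F : (τ → ℂ) → (Slot m p → R × ℂ) → M} (hF : PolyFamily F) :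
    PolyFamily fun lam => diff ρ p (F lam) := by
  induction p with
  | zero =>
    intro X hX
    simp only [diff_zero_apply, dOne_apply]
    refine IsPoly.add (IsPoly.neg (hF _ fun _ => PolyPair.brP fun k => hX _))
      (IsPoly.sum _ fun k _ => IsPoly.const_smul (IsPoly.acP ρ (fun j => hX _)
        (hF _ fun _ => hX _)) _)
  | succ p ih =>
    intro X hX
    refine IsPoly.sub (PolyFamily.lieDer ρ hF (fun k => hX _) _ fun s => hX _)
      (ih (F := fun lam => contr (headS (X lam)) (F lam)) (fun Y hY => hF _ fun s => ?_) _
        fun s => hX _)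
    induction s using Slot.cases_shift with
    | h0 j => exact hX _
    | hs s => simpa only [consS_shift] using hY s

/-! ### Cochains as functions of pairs, and the differential on cochains. -/

/-- The function of families of pairs given by a multilinear map with polynomial values. -/
def toFun {σ : Type*} :
    MultilinearMap ℂ (fun _ : σ => R) (LPoly σ M) →ₗ[ℂ] ((σ → R × ℂ) → M) where
  toFun γ X := ev (fun s => (X s).2) (γ fun s => (X s).1)
  map_add' γ δ := by
    funext X
    simp only [add_apply, map_add, Pi.add_apply]
  map_smul' c γ := by
    funext X
    simp only [smul_apply, map_smul, Pi.smul_apply, RingHom.id_apply]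

theorem toFun_apply {σ : Type*} (γ : MultilinearMap ℂ (fun _ : σ => R) (LPoly σ M))
    (X : σ → R × ℂ) : toFun γ X = ev (fun s => (X s).2) (γ fun s => (X s).1) := rfl

theorem toFun_injective {σ : Type*} : Function.Injective
    (toFun : MultilinearMap ℂ (fun _ : σ => R) (LPoly σ M) →ₗ[ℂ] ((σ → R × ℂ) → M)) := by
  intro γ δ h
  ext a
  exact ev_injective fun lam => congrFun h fun s => (a s, lam s)

theorem update_pair {σ : Type*} [DecidableEq σ] (a : σ → R) (lam : σ → ℂ) (s : σ) (r : R) :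
    (fun t => (Function.update a s r t, lam t)) =
      Function.update (fun t => (a t, lam t)) s (r, lam s) := by
  funext t
  by_cases h : t = s
  · subst h; simp
  · simp [h]

theorem polyFamily_toFun {σ : Type*} [Fintype σ]
    (γ : MultilinearMap ℂ (fun _ : σ => R) (LPoly σ M)) :
    PolyFamily fun _ : τ → ℂ => toFun γ :=
  fun _ hX => isPoly_multilinear (fun s => (hX s).2) γ fun s => (hX s).1

theorem slotAdm_toFun {p : ℕ} (γ : Cochain m p R M) : SlotAdm (toFun γ.1) := by
  intro X s l
  have h : ∀ r : R, toFun γ.1 (Function.update X s (r, l)) =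
      ev (Function.update (fun t => (X t).2) s l)
        (γ.1 (Function.update (fun t => (X t).1) s r)) := by
    intro r
    rw [toFun_apply]
    congr 1
    · congr 1
      funext t
      by_cases h : t = s
      · subst h; simp
      · simp [h]
    · congr 1
      funext t
      by_cases h : t = s
      · subst h; simp
      · simp [h]
  simp only [h]
  refine ⟨fun a b => ?_, fun c a => ?_, fun a => ?_⟩
  · rw [MultilinearMap.map_update_add, map_add]
  · rw [MultilinearMap.map_update_smul, map_smul]
  · have := γ.2.1 (Function.update (fun t => (X t).2) s l)
      (Function.update (fun t => (X t).1) s a) s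
    simpa using this

theorem blockSkew_toFun {p : ℕ} (γ : Cochain m p R M) : BlockSkew (toFun γ.1) := by
  intro s t hst hb X
  have := γ.2.2 s.block (Equiv.swap s t) (fun r hr => ?_) (fun r => (X r).2) (fun r => (X r).1)
  · rw [Equiv.Perm.sign_swap hst, Units.val_neg, Units.val_one, Int.cast_neg, Int.cast_one,
      neg_one_smul] at this
    exact this
  · rcases eq_or_ne r s with rfl | h1
    · rfl
    · rcases eq_or_ne r t with rfl | h2
      · exact hb.symm
      · exact absurd (Equiv.swap_apply_of_ne_of_ne h1 h2) hr

/-- Functions of families that are polynomial, admissible in every entry and skew-symmetric in the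
blocks come from cochains. -/
theorem exists_cochain {p : ℕ} {g : (Slot m p → R × ℂ) → M} (hg : SlotAdm g) (hs : BlockSkew g)
    (hp : PolyFamily fun _ : Slot m p → ℂ => g) : ∃ δ : Cochain m p R M, toFun δ.1 = g := by
  have hex : ∀ a : Slot m p → R, ∃ P : LPoly (Slot m p) M,
      ∀ lam, ev lam P = g fun s => (a s, lam s) := fun a =>
    hp (fun lam s => (a s, lam s)) fun s => ⟨isPoly_const (a s), MvPolynomial.X s, fun lam => by simp⟩
  choose P hP using hex
  -- The polynomials are chosen separately for each `a`; they depend on it multilinearly because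
  -- their values do.
  let δ : MultilinearMap ℂ (fun _ : Slot m p => R) (LPoly (Slot m p) M) := MultilinearMap.mk' P
    (fun a s x y => ev_injective fun lam => by
      rw [map_add, hP, hP, hP, update_pair, update_pair, update_pair]
      exact (hg _ s (lam s)).1 x y)
    (fun a s c x => ev_injective fun lam => by
      rw [map_smul, hP, hP, update_pair, update_pair]
      exact (hg _ s (lam s)).2.1 c x)
  have hδ : ∀ lam a, ev lam (δ a) = g fun s => (a s, lam s) := fun lam a => hP a lam
  refine ⟨⟨δ, fun lam a s => ?_, fun i π hπ lam a => ?_⟩, ?_⟩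
  · rw [hδ, hδ, update_pair]
    refine ((hg _ s (lam s)).2.2 (a s)).trans ?_
    simp only
    rw [Function.update_eq_self_iff.mpr rfl]
  · rw [hδ, hδ]
    exact skew_of_swap g (fun s => s.block = i)
      (fun s t hst h1 h2 X => hs s t hst (h1.trans h2.symm) X) π hπ fun s => (a s, lam s)
  · funext X
    exact hδ _ _

theorem exists_cochainDiff (p : ℕ) (γ : Cochain m p R M) :
    ∃ δ : Cochain m (p + 1) R M, toFun δ.1 = diff ρ p (toFun γ.1) :=
  exists_cochain ((slotAdm_toFun γ).diff ρ p) ((blockSkew_toFun γ).diff ρ p (slotAdm_toFun γ))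
    (PolyFamily.diff ρ p (polyFamily_toFun γ.1))

/-- The differential on cochains. -/
def cochainDiff (p : ℕ) : Cochain m p R M →ₗ[ℂ] Cochain m (p + 1) R M where
  toFun γ := (exists_cochainDiff ρ p γ).choose
  map_add' γ δ := by
    -- A cochain is determined by its function of pairs, so linearity of the choice follows from
    -- linearity of `diff`.
    refine Subtype.ext (toFun_injective ?_)
    refine (exists_cochainDiff ρ p (γ + δ)).choose_spec.trans ?_
    rw [Submodule.coe_add, map_add, map_add, Submodule.coe_add, map_add]
    exact congrArg₂ _ (exists_cochainDiff ρ p γ).choose_spec.symm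
      (exists_cochainDiff ρ p δ).choose_spec.symm
  map_smul' c γ := by
    refine Subtype.ext (toFun_injective ?_)
    refine (exists_cochainDiff ρ p (c • γ)).choose_spec.trans ?_
    rw [RingHom.id_apply, Submodule.coe_smul, map_smul, map_smul, Submodule.coe_smul, map_smul]
    exact congrArg _ (exists_cochainDiff ρ p γ).choose_spec.symm

theorem toFun_cochainDiff (p : ℕ) (γ : Cochain m p R M) :
    toFun (cochainDiff ρ p γ).1 = diff ρ p (toFun γ.1) :=
  (exists_cochainDiff ρ p γ).choose_spec

theorem slots_pair {p : ℕ} {S T : Type*} (a : Fin p → Fin (m + 1) → S) (z : S)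
    (lam : Fin p → Fin (m + 1) → T) (mu : T) :
    slots (fun i j => (a i j, lam i j)) (z, mu) = fun s => (slots a z s, slots lam mu s) := by
  funext s
  rcases s with _ | ⟨i, j⟩ <;> rfl

theorem ev_slots {p : ℕ} (γ : MultilinearMap ℂ (fun _ : Slot m p => R) (LPoly (Slot m p) M))
    (lam : Fin p → Fin (m + 1) → ℂ) (mu : ℂ) (a : Fin p → Fin (m + 1) → R) (z : R) :
    ev (slots lam mu) (γ (slots a z)) = toFun γ (slots (fun i j => (a i j, lam i j)) (z, mu)) := by
  rw [slots_pair]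
  rfl

theorem brP_snoc_eq (x : Fin (m + 1) → R × ℂ) (u : R × ℂ) :
    brP L (Fin.snoc x u) =
      (L.br (fun k => (x k).2) (fun k => (x k).1) u.1, u.2 + ∑ k, (x k).2) := by
  simp [brP, Fin.sum_univ_castSucc (n := m + 1), add_comm]

theorem diffValue_eq (p : ℕ) (γ : Cochain m p R M) (lam : Fin (p + 1) → Fin (m + 1) → ℂ) (mu : ℂ)
    (a : Fin (p + 1) → Fin (m + 1) → R) (z : R) :
    diffValue ρ γ lam mu a z =
      diff ρ p (toFun γ.1) (slots (fun i j => (a i j, lam i j)) (z, mu)) := by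
  have hsnoc : ∀ (b : Fin m → R) (l : Fin m → ℂ) (v : M),
      ρ.ac (Fin.snoc l mu) (Fin.snoc b z) v =
        acP ρ (Fin.snoc (α := fun _ => R × ℂ) (fun k => (b k, l k)) (z, mu)) v := by
    intro b l v
    rw [acP_apply]
    congr 1 <;> funext k <;> induction k using Fin.lastCases <;> simp
  have hupd : ∀ (i j : Fin (p + 1)) (l : Fin (m + 1)) (b : R) (c : ℂ),
      (fun i' k => (i.removeNth (Function.update a j (Function.update (a j) l b)) i' k,
        i.removeNth (Function.update lam j (Function.update (lam j) l c)) i' k)) =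
      i.removeNth (Function.update (fun i k => (a i k, lam i k)) j
        (Function.update (fun k => (a j k, lam j k)) l (b, c))) := by
    intro i j l b c
    funext i' k
    simp only [Fin.removeNth_apply]
    by_cases h : i.succAbove i' = j
    · subst h
      by_cases hk : k = l
      · subst hk; simp
      · simp [hk]
    · simp [h]
  rw [diff_slots, diffValue, fourSum]
  simp only [val, ev_slots, hsnoc, hupd, brP_snoc_eq]
  rfl

end

end NLieConformal

end

theorem mainTheorem3 (m : ℕ) (R : Type*) [AddCommGroup R] [Module ℂ R] [Module ℂ[X] R]
    [IsScalarTower ℂ ℂ[X] R] (L : NLieConformal.NLieConformalAlgebra m R)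
    (M : Type*) [AddCommGroup M] [Module ℂ M] [Module ℂ[X] M] [IsScalarTower ℂ ℂ[X] M]
    (ρ : NLieConformal.ConformalRep L M) :
    ∃ D : ∀ p : ℕ,
        NLieConformal.Cochain m p R M →ₗ[ℂ] NLieConformal.Cochain m (p + 1) R M,
      -- `D` is given by the four-summand formula
      (∀ (p : ℕ) (γ : NLieConformal.Cochain m p R M) (lam : Fin (p + 1) → Fin (m + 1) → ℂ) (mu : ℂ)
        (a : Fin (p + 1) → Fin (m + 1) → R) (z : R),
        NLieConformal.val (D p γ) lam mu a z = NLieConformal.diffValue ρ γ lam mu a z) ∧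
      -- the formula determines `D γ`, even among all multilinear maps to polynomials
      (∀ (p : ℕ) (γ : NLieConformal.Cochain m p R M)
        (δ : MultilinearMap ℂ (fun _ : NLieConformal.Slot m (p + 1) => R)
          (NLieConformal.LPoly (NLieConformal.Slot m (p + 1)) M)),
        (∀ (lam : Fin (p + 1) → Fin (m + 1) → ℂ) (mu : ℂ)
          (a : Fin (p + 1) → Fin (m + 1) → R) (z : R),
          NLieConformal.ev (NLieConformal.slots lam mu) (δ (NLieConformal.slots a z)) =
            NLieConformal.diffValue ρ γ lam mu a z) →
        δ = (D p γ).1) ∧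
      -- `D² = 0`
      (∀ p : ℕ, (D (p + 1)).comp (D p) = 0) := by
  refine ⟨NLieConformal.cochainDiff ρ, fun p γ lam mu a z => ?_, fun p γ δ h => ?_, fun p => ?_⟩
  · rw [NLieConformal.val, NLieConformal.ev_slots, NLieConformal.toFun_cochainDiff,
      NLieConformal.diffValue_eq]
  · apply NLieConformal.toFun_injective
    funext X
    -- Every family of pairs comes from blocks and a last entry, so the formula prescribes all
    -- values of δ.
    have hX : X = NLieConformal.slots
        (fun i j => ((X (some (i, j))).1, (X (some (i, j))).2)) ((X none).1, (X none).2) := by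
      funext s
      rcases s with _ | ⟨i, j⟩ <;> rfl
    rw [hX, ← NLieConformal.ev_slots, h, NLieConformal.diffValue_eq,
      NLieConformal.toFun_cochainDiff]
  · refine LinearMap.ext fun γ => Subtype.ext (NLieConformal.toFun_injective ?_)
    rw [LinearMap.comp_apply, NLieConformal.toFun_cochainDiff, NLieConformal.toFun_cochainDiff,
      NLieConformal.diff_diff ρ p (NLieConformal.slotAdm_toFun γ), LinearMap.zero_apply,
      Submodule.coe_zero, map_zero]
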